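/- Let $N\ge 1$ be an integer and $s\in(0,1)$. Let $\rho\in C(\mathbb{R}^N)$ with $\rho>0$ in $\mathbb{R}^N$, and suppose that for some $K>0$ and some real $\alpha\le 2s$ $$\rho(x)\ \ge\ K(1+|x|^2)^{-\alpha}\qquad\text{for all }x\in\mathbb{R}^N .$$ Let $c\in C(\mathbb{R}^N)\cap L^\infty(\mathbb{R}^N)$, $c\ge 0$, and suppose that for some constant $c_0>0$ one has $c(x)\ge c_0$ for all $x\in\mathbb{R}^N$. Let $u$ be a solution of $$(-\Delta)^s u+\rho\, c\, u=0\quad\text{in }\mathbb{R}^N$$ in the following sense: $u:\mathbb{R}^N\to\mathbb{R}$ is measurable with $\int_{\mathbb{R}^N}\frac{|u(x)|}{1+|x|^{N+2s}}\,dx<\infty$; for some $\gamma>0$, $u\in C^{2s+\gamma}_{loc}(\mathbb{R}^N)$ if $s<\tfrac12$, and $u\in C^{1,2s+\gamma-1}_{loc}(\mathbb{R}^N)$ if $s\ge\tfrac12$; and for every $x\in\mathbb{R}^N$ the principal value below exists and $$C_{N,s}\ \mathrm{P.V.}\!\int_{\mathbb{R}^N}\frac{u(x)-u(y)}{|x-y|^{N+2s}}\,dy+\rho(x)c(x)u(x)=0,\qquad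 C_{N,s}=\frac{2^{2s-1}\,2s\,\Gamma\big(\tfrac{N+2s}{2}\big)}{\pi^{N/2}\,\Gamma(1-s)} .$$ If, for some $p\ge 1$, $$\int_{\mathbb{R}^N}\frac{|u(x)|^p}{1+|x|^{N-2s+\alpha}}\,dx<\infty ,$$ then $u\equiv 0$ in $\mathbb{R}^N$. -/

import Mathlib

open Filter Topology MeasureTheory
open scoped NNReal ENNReal

noncomputable section

/-- The normalizing constant `C_{N,s}` of the fractional Laplacian. -/
def fracLapConst (N : ℕ) (s : ℝ) : ℝ :=
  2 ^ (2 * s - 1) * (2 * s) * Real.Gamma (((N : ℝ) + 2 * s) / 2) /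
    (Real.pi ^ ((N : ℝ) / 2) * Real.Gamma (1 - s))

/-- The principal value `C_{N,s} P.V. ∫ (u x - u y) / |x - y|^(N+2s) dy` exists and equals `L`:
the integrals over `|x - y| > ε` converge to `L` as `ε → 0⁺`. -/
def HasFracLaplacianAt {N : ℕ} (s : ℝ) (u : EuclideanSpace ℝ (Fin N) → ℝ)
    (x : EuclideanSpace ℝ (Fin N)) (L : ℝ) : Prop :=
  Tendsto
    (fun ε : ℝ => fracLapConst N s *
      ∫ y in {y : EuclideanSpace ℝ (Fin N) | ε < ‖x - y‖},
        (u x - u y) / ‖x - y‖ ^ ((N : ℝ) + 2 * s))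
    (𝓝[>] 0) (𝓝 L)

/-- The weighted Lebesgue space: measurable `u` with `∫ |u|^p w < ∞`. -/
def MemWeightedLp {N : ℕ} (p : ℝ) (w u : EuclideanSpace ℝ (Fin N) → ℝ) : Prop :=
  Measurable u ∧ Integrable (fun x => |u x| ^ p * w x)

/-- The space `𝓛^s(ℝ^N)`: measurable `u` with `∫ |u| / (1 + |x|^(N+2s)) < ∞`. -/
def MemFracL {N : ℕ} (s : ℝ) (u : EuclideanSpace ℝ (Fin N) → ℝ) : Prop :=
  Measurable u ∧ Integrable (fun x => |u x| / (1 + ‖x‖ ^ ((N : ℝ) + 2 * s)))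

/-- `f` is Hölder continuous with exponent `θ` on every compact set. -/
def LocallyHolder {N : ℕ} {F : Type*} [NormedAddCommGroup F] (θ : ℝ≥0)
    (f : EuclideanSpace ℝ (Fin N) → F) : Prop :=
  ∀ S : Set (EuclideanSpace ℝ (Fin N)), IsCompact S → ∃ C : ℝ≥0, HolderOnWith C θ f S

/-- The regularity required of a solution, for some `γ > 0`: local Hölder continuity with
exponent `θ = 2s + γ` if `s < 1/2`; `C¹` with locally Hölder continuous derivative of exponent
`θ = 2s + γ - 1` if `s ≥ 1/2`.  Only exponents `θ ≤ 1` are used: since the condition is local and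
`γ` may be decreased, this excludes nothing. -/
def FracRegular {N : ℕ} (s : ℝ) (u : EuclideanSpace ℝ (Fin N) → ℝ) : Prop :=
  (s < 1 / 2 → ∃ θ : ℝ≥0, 2 * s < θ ∧ θ ≤ 1 ∧ LocallyHolder θ u) ∧
  (1 / 2 ≤ s → ContDiff ℝ 1 u ∧
    ∃ θ : ℝ≥0, 2 * s - 1 < θ ∧ θ ≤ 1 ∧ LocallyHolder θ (fderiv ℝ u))

/-- `u` is a (pointwise) solution of `(-Δ)^s u + ρ c u = 0` in `ℝ^N`. -/
structure IsFracEllipticSolution {N : ℕ} (s : ℝ) (ρ c u : EuclideanSpace ℝ (Fin N) → ℝ) :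
    Prop where
  memFracL : MemFracL s u
  regular : FracRegular s u
  equation : ∀ x, ∃ L : ℝ, HasFracLaplacianAt s u x L ∧ L + ρ x * c x * u x = 0

end

/-! Write V = ρ c, which is continuous and positive. By convexity of |t|^p, the function |u|^p
satisfies (-Δ)^s |u|^p + p V |u|^p ≤ 0 weakly. Testing with φ ≥ 0 of compact support gives p ∫ V
|u|^p φ ≤ C ∫ |u|^p E whenever (-Δ)^s φ ≥ -E, up to normalization (`integral_potential_le`). All
integrations by parts are done for operators truncated at ‖x - y‖ > ε, which are symmetric. Only the
truncated operator of u itself is sent to the limit, because |u|^p need not be regular enough to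
have a pointwise fractional Laplacian.

Since α ≤ 2s, the integrability hypothesis yields ∫ |u|^p (1 + ‖x‖)^(-N) < ∞. Hence it suffices to
find increasing cutoffs φ_n, eventually positive at each point, whose errors E_n are dominated by a
multiple of (1 + ‖x‖)^(-N) and tend to 0 pointwise (`eq_zero_of_test_functions`). Dominated
convergence then forces ∫ V |u|^p φ_n = 0.

If N ≤ 2s, rescaled bumps have errors of size max(n, ‖x‖)^(-2s), which is enough
(`eq_zero_of_le_two_mul`). If N > 2s this decay is too weak, and the cutoffs are built from the
fundamental solution ‖x‖^(-(N-2s)) (`eq_zero_of_two_mul_lt`). It is superharmonic for every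
truncated operator, by an inversion argument (`truncOp_norm_rpow_nonneg`). A convex cutoff at level
δ loses only a second-order term proportional to min(δ, ‖x‖^(-(N-2s))) (`convexCutoff_sub_le`).
Multiplied by ‖x‖^(-2s), this is at most of order ‖x‖^(-N) and vanishes as δ → 0. -/

noncomputable section

/-- The kernel `‖z‖^(-a)` with the ball of radius `ε` removed. -/
def truncKernel {N : ℕ} (a ε : ℝ) (z : EuclideanSpace ℝ (Fin N)) : ℝ :=
  if ε < ‖z‖ then ‖z‖ ^ (-a) else 0

/-- The truncated nonlocal operator `∫_{‖x - y‖ > ε} (f x - f y) ‖x - y‖^(-a) dy`. -/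
def truncOp {N : ℕ} (a ε : ℝ) (f : EuclideanSpace ℝ (Fin N) → ℝ)
    (x : EuclideanSpace ℝ (Fin N)) : ℝ :=
  ∫ y, (f x - f y) * truncKernel a ε (x - y)

/-! ### Truncated kernels and operators: integrability, second differences, symmetry. -/

section Kernel

variable {N : ℕ}

lemma truncKernel_nonneg (a ε : ℝ) (z : EuclideanSpace ℝ (Fin N)) : 0 ≤ truncKernel a ε z := by
  unfold truncKernel; split_ifs <;> positivity

lemma truncKernel_neg (a ε : ℝ) (z : EuclideanSpace ℝ (Fin N)) :
    truncKernel a ε (-z) = truncKernel a ε z := by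
  simp [truncKernel]

lemma truncKernel_sub_comm (a ε : ℝ) (x y : EuclideanSpace ℝ (Fin N)) :
    truncKernel a ε (x - y) = truncKernel a ε (y - x) := by
  rw [← truncKernel_neg, neg_sub]

lemma measurable_truncKernel (a ε : ℝ) :
    Measurable (truncKernel a ε : EuclideanSpace ℝ (Fin N) → ℝ) := by
  unfold truncKernel
  exact Measurable.ite (measurableSet_lt measurable_const measurable_norm) (by fun_prop)
    measurable_const

/-- Off the ε-ball, 1 + ‖y‖ ≤ 1 + r + ‖x - y‖, and 1 + r is absorbed into (1 + r)/ε · ‖x - y‖. The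
constant is uniform for x in a ball, which is what Fubini and the later uniform bounds require. -/
lemma truncKernel_sub_le {a ε r : ℝ} (ha : 0 < a) (hε : 0 < ε) (hr : 0 ≤ r)
    {x : EuclideanSpace ℝ (Fin N)} (hx : ‖x‖ ≤ r) (y : EuclideanSpace ℝ (Fin N)) :
    truncKernel a ε (x - y) ≤ (1 + (1 + r) / ε) ^ a * (1 + ‖y‖) ^ (-a) := by
  unfold truncKernel
  split_ifs with h
  · have h0 : 0 < ‖x - y‖ := hε.trans h
    have h1 : 1 + ‖y‖ ≤ (1 + (1 + r) / ε) * ‖x - y‖ := by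
      have h2 : ‖y‖ ≤ ‖x‖ + ‖x - y‖ := by
        have := norm_sub_le x (x - y); simpa using this
      have h3 : 1 + r ≤ (1 + r) / ε * ‖x - y‖ := by
        rw [div_mul_eq_mul_div, le_div_iff₀ hε]
        exact mul_le_mul_of_nonneg_left h.le (by linarith)
      nlinarith
    have hpos : 0 < 1 + (1 + r) / ε := by positivity
    have hy : 0 < 1 + ‖y‖ := by positivity
    rw [Real.rpow_neg h0.le, Real.rpow_neg hy.le, ← div_eq_mul_inv, le_div_iff₀ (by positivity),
      inv_mul_le_iff₀ (by positivity), mul_comm, ← Real.mul_rpow hpos.le h0.le]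
    exact Real.rpow_le_rpow hy.le h1 ha.le
  · positivity

lemma integrable_truncKernel {a ε : ℝ} (ha : (N : ℝ) < a) (hε : 0 < ε) :
    Integrable (truncKernel a ε : EuclideanSpace ℝ (Fin N) → ℝ) := by
  have ha0 : 0 < a := (Nat.cast_nonneg N).trans_lt ha
  have h := (integrable_one_add_norm (E := EuclideanSpace ℝ (Fin N)) (μ := volume) (r := a)
    (by simpa using ha)).const_mul ((1 + (1 + 0) / ε) ^ a)
  refine h.mono' (measurable_truncKernel a ε).aestronglyMeasurable (ae_of_all _ fun y => ?_)
  rw [Real.norm_of_nonneg (truncKernel_nonneg _ _ _)]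
  have := truncKernel_sub_le (x := 0) ha0 hε le_rfl (by simp) y
  rwa [zero_sub, truncKernel_neg] at this

lemma integrable_truncKernel_sub {a ε : ℝ} (ha : (N : ℝ) < a) (hε : 0 < ε)
    (x : EuclideanSpace ℝ (Fin N)) : Integrable (fun y => truncKernel a ε (x - y)) :=
  (integrable_truncKernel ha hε).comp_sub_left x

lemma integrable_mul_truncKernel {a ε : ℝ} (ha : 0 < a) (hε : 0 < ε)
    {f : EuclideanSpace ℝ (Fin N) → ℝ} (hf : Measurable f)
    (hfi : Integrable fun y => |f y| * (1 + ‖y‖) ^ (-a)) (x : EuclideanSpace ℝ (Fin N)) :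
    Integrable (fun y => f y * truncKernel a ε (x - y)) := by
  refine (hfi.const_mul ((1 + (1 + ‖x‖) / ε) ^ a)).mono'
    (hf.mul ((measurable_truncKernel a ε).comp (by fun_prop))).aestronglyMeasurable
    (ae_of_all _ fun y => ?_)
  rw [norm_mul, Real.norm_eq_abs, Real.norm_of_nonneg (truncKernel_nonneg _ _ _)]
  calc _ ≤ |f y| * ((1 + (1 + ‖x‖) / ε) ^ a * (1 + ‖y‖) ^ (-a)) :=
        mul_le_mul_of_nonneg_left (truncKernel_sub_le ha hε (norm_nonneg x) le_rfl y)
          (abs_nonneg _)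
    _ = _ := by ring

lemma integrable_diff_mul_truncKernel {a ε : ℝ} (ha : (N : ℝ) < a) (hε : 0 < ε)
    {f : EuclideanSpace ℝ (Fin N) → ℝ} (hf : Measurable f)
    (hfi : Integrable fun y => |f y| * (1 + ‖y‖) ^ (-a)) (x : EuclideanSpace ℝ (Fin N)) (c : ℝ) :
    Integrable (fun y => (c - f y) * truncKernel a ε (x - y)) := by
  have ha0 : 0 < a := (Nat.cast_nonneg N).trans_lt ha
  simp_rw [sub_mul]
  exact ((integrable_truncKernel_sub ha hε x).const_mul _).sub
    (integrable_mul_truncKernel ha0 hε hf hfi x)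

lemma integrable_norm_rpow_of_le_one (hN : 1 ≤ N) {b : ℝ} (hb : -(N : ℝ) < b) :
    Integrable (fun h : EuclideanSpace ℝ (Fin N) => if ‖h‖ ≤ 1 then ‖h‖ ^ b else 0) := by
  have : Nonempty (Fin N) := ⟨⟨0, hN⟩⟩
  rw [integrable_fun_norm_addHaar (volume : Measure (EuclideanSpace ℝ (Fin N)))
    (f := fun t : ℝ => if t ≤ 1 then t ^ b else 0)]
  have h1 : IntegrableOn (fun t : ℝ => t ^ (N - 1 + b)) (Set.Ioc 0 1) := by
    have := intervalIntegral.intervalIntegrable_rpow' (a := 0) (b := 1) (r := N - 1 + b)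
      (by linarith)
    rwa [intervalIntegrable_iff_integrableOn_Ioc_of_le zero_le_one] at this
  have h2 := h1.integrable_indicator measurableSet_Ioc
  refine (h2.integrableOn (s := Set.Ioi 0)).congr_fun (fun t ht => ?_) measurableSet_Ioi
  have ht : (0 : ℝ) < t := ht
  simp only [finrank_euclideanSpace, Fintype.card_fin, smul_eq_mul, Set.indicator, Set.mem_Ioc]
  by_cases h : t ≤ 1
  · rw [if_pos ⟨ht, h⟩, if_pos h, Real.rpow_add ht, ← Real.rpow_natCast]
    push_cast [Nat.cast_sub hN]
    rfl
  · rw [if_neg (fun hh => h hh.2), if_neg h, mul_zero]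

/-- The principal value of the fractional Laplacian in terms of the truncated operators. -/
lemma hasFracLaplacianAt_iff_truncOp {s : ℝ} (u : EuclideanSpace ℝ (Fin N) → ℝ)
    (x : EuclideanSpace ℝ (Fin N)) (L : ℝ) :
    HasFracLaplacianAt s u x L ↔
      Tendsto (fun ε : ℝ => fracLapConst N s * truncOp (N + 2 * s) ε u x) (𝓝[>] 0) (𝓝 L) := by
  unfold HasFracLaplacianAt truncOp
  refine iff_of_eq ?_
  congr 1
  funext ε
  congr 1
  rw [← integral_indicator]
  · refine integral_congr_ae (ae_of_all _ fun y => ?_)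
    simp only [Set.indicator, truncKernel, Set.mem_ofPred_eq]
    split_ifs
    · rw [Real.rpow_neg (norm_nonneg _), div_eq_mul_inv]
    · simp
  · exact measurableSet_lt measurable_const (by fun_prop)

lemma truncOp_eq {a ε : ℝ} (ha : (N : ℝ) < a) (hε : 0 < ε)
    {f : EuclideanSpace ℝ (Fin N) → ℝ} (hf : Measurable f)
    (hfi : Integrable fun y => |f y| * (1 + ‖y‖) ^ (-a)) (x : EuclideanSpace ℝ (Fin N)) :
    truncOp a ε f x = f x * (∫ h : EuclideanSpace ℝ (Fin N), truncKernel a ε h) -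
      ∫ y, f y * truncKernel a ε (x - y) := by
  have ha0 : 0 < a := (Nat.cast_nonneg N).trans_lt ha
  unfold truncOp
  simp_rw [sub_mul]
  rw [integral_sub ((integrable_truncKernel_sub ha hε x).const_mul _)
    (integrable_mul_truncKernel ha0 hε hf hfi x), integral_const_mul,
    integral_sub_left_eq_self (fun h => truncKernel a ε h) volume x]

lemma measurable_truncOp {a ε : ℝ} {f : EuclideanSpace ℝ (Fin N) → ℝ} (hf : Measurable f) :
    StronglyMeasurable (truncOp a ε f) := by
  unfold truncOp
  refine StronglyMeasurable.integral_prod_right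
    (f := fun x y => (f x - f y) * truncKernel a ε (x - y)) (Measurable.stronglyMeasurable ?_)
  have := measurable_truncKernel (N := N) a ε
  simp only [Function.uncurry_def]
  fun_prop

/-- The truncated operator in terms of second differences. -/
lemma truncOp_eq_second_diff {a ε : ℝ} (ha : (N : ℝ) < a) (hε : 0 < ε)
    {f : EuclideanSpace ℝ (Fin N) → ℝ} (hf : Measurable f)
    (hfi : Integrable fun y => |f y| * (1 + ‖y‖) ^ (-a)) (x : EuclideanSpace ℝ (Fin N)) :
    Integrable (fun h => (2 * f x - f (x + h) - f (x - h)) * truncKernel a ε h) ∧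
    truncOp a ε f x =
      (1 / 2) * ∫ h, (2 * f x - f (x + h) - f (x - h)) * truncKernel a ε h := by
  have hi := integrable_diff_mul_truncKernel ha hε hf hfi x (f x)
  have hi1 : Integrable (fun h => (f x - f (x - h)) * truncKernel a ε h) := by
    simpa using hi.comp_sub_left x
  have hi2 : Integrable (fun h => (f x - f (x + h)) * truncKernel a ε h) := by
    simpa [truncKernel_neg] using hi.comp_add_left x
  have e1 : truncOp a ε f x = ∫ h, (f x - f (x - h)) * truncKernel a ε h := by
    rw [truncOp, ← integral_sub_left_eq_self _ volume x]; simp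
  have e2 : truncOp a ε f x = ∫ h, (f x - f (x + h)) * truncKernel a ε h := by
    rw [truncOp, ← integral_add_left_eq_self _ x]; simp [truncKernel_neg]
  have e3 : (fun h => (2 * f x - f (x + h) - f (x - h)) * truncKernel a ε h) =
      fun h => (f x - f (x - h)) * truncKernel a ε h + (f x - f (x + h)) * truncKernel a ε h := by
    funext h; ring
  rw [e3]
  refine ⟨hi1.add hi2, ?_⟩
  rw [integral_add hi1 hi2, ← e1, ← e2]
  ring

/-- The truncated operator is symmetric. -/
lemma integral_mul_truncOp_comm {a ε : ℝ} (ha : (N : ℝ) < a) (hε : 0 < ε)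
    {φ w : EuclideanSpace ℝ (Fin N) → ℝ} (hφ : Continuous φ) (hφc : HasCompactSupport φ)
    (hw : Continuous w) (hwi : Integrable fun y => |w y| * (1 + ‖y‖) ^ (-a)) :
    Integrable (fun x => φ x * truncOp a ε w x) ∧ Integrable (fun x => w x * truncOp a ε φ x) ∧
    ∫ x, φ x * truncOp a ε w x = ∫ x, w x * truncOp a ε φ x := by
  have ha0 : 0 < a := (Nat.cast_nonneg N).trans_lt ha
  have hφi : Integrable φ := hφ.integrable_of_hasCompactSupport hφc
  have hφi' : Integrable fun y => |φ y| * (1 + ‖y‖) ^ (-a) := by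
    refine Continuous.integrable_of_hasCompactSupport ?_ ?_
    · exact hφ.abs.mul (Continuous.rpow_const (by fun_prop) fun y => Or.inl (by positivity))
    · exact (hφc.comp_left (g := abs) abs_zero).mul_right
  have hφw : Integrable fun x => φ x * w x :=
    (hφ.mul hw).integrable_of_hasCompactSupport hφc.mul_right
  obtain ⟨r, hr0, hr⟩ : ∃ r : ℝ, 0 ≤ r ∧ ∀ x, φ x ≠ 0 → ‖x‖ ≤ r := by
    obtain ⟨r, hr⟩ := hφc.isCompact.isBounded.exists_norm_le
    exact ⟨max r 0, le_max_right _ _, fun x hx =>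
      (hr x (subset_tsupport _ hx)).trans (le_max_left _ _)⟩
  -- The compact support of φ confines x to a ball, so the kernel is dominated by a function of y
  -- alone and the double integral is absolutely convergent.
  have hprod : Integrable (Function.uncurry fun x y => φ x * (w y * truncKernel a ε (x - y)))
      (volume.prod volume) := by
    refine ((hφi.abs.mul_prod hwi).const_mul ((1 + (1 + r) / ε) ^ a)).mono' ?_
      (ae_of_all _ fun z => ?_)
    · have := measurable_truncKernel (N := N) a ε
      have := hφ.measurable
      have := hw.measurable
      simp only [Function.uncurry_def]
      exact Measurable.aestronglyMeasurable (by fun_prop)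
    · obtain ⟨x, y⟩ := z
      simp only [Function.uncurry_apply_pair, norm_mul, Real.norm_eq_abs,
        abs_of_nonneg (truncKernel_nonneg a ε (x - y))]
      by_cases hx : φ x = 0
      · simp [hx]
      · calc _ ≤ |φ x| * (|w y| * ((1 + (1 + r) / ε) ^ a * (1 + ‖y‖) ^ (-a))) := by
              gcongr
              exact truncKernel_sub_le ha0 hε hr0 (hr x hx) y
          _ = _ := by ring
  have hswap := integral_integral_swap hprod
  have hI1 : Integrable (fun x => ∫ y, φ x * (w y * truncKernel a ε (x - y))) :=
    hprod.integral_prod_left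
  have hI2 : Integrable (fun y => ∫ x, φ x * (w y * truncKernel a ε (x - y))) :=
    hprod.integral_prod_right
  set κ := ∫ h : EuclideanSpace ℝ (Fin N), truncKernel a ε h
  have e1 : (fun x => φ x * truncOp a ε w x) =
      fun x => φ x * w x * κ - ∫ y, φ x * (w y * truncKernel a ε (x - y)) := by
    funext x
    rw [truncOp_eq ha hε hw.measurable hwi, integral_const_mul]; ring
  have e2 : (fun x => w x * truncOp a ε φ x) =
      fun y => φ y * w y * κ - ∫ x, φ x * (w y * truncKernel a ε (x - y)) := by
    funext y
    rw [truncOp_eq ha hε hφ.measurable hφi']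
    have : (fun x => φ x * (w y * truncKernel a ε (x - y))) =
        fun x => w y * (φ x * truncKernel a ε (y - x)) := by
      funext x; rw [truncKernel_sub_comm]; ring
    rw [this, integral_const_mul]; ring
  rw [e1, e2]
  refine ⟨(hφw.mul_const κ).sub hI1, (hφw.mul_const κ).sub hI2, ?_⟩
  rw [integral_sub (hφw.mul_const κ) hI1, integral_sub (hφw.mul_const κ) hI2, hswap]

end Kernel

/-! ### Convexity inequality and the weak form for |u|^p. -/

section Weak

variable {N : ℕ}

/-- Subgradient inequality for the convex function |t|^p at a. It is Bernoulli's inequality for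
|b|/|a|, and the sign factor selects a subgradient also when p = 1. -/
lemma abs_rpow_tangent_le {p : ℝ} (hp : 1 ≤ p) (a b : ℝ) :
    |a| ^ p - |b| ^ p ≤ p * |a| ^ (p - 1) * SignType.sign a * (a - b) := by
  rcases eq_or_ne a 0 with rfl | ha
  · have : (0 : ℝ) ≤ |b| ^ p := by positivity
    simp [Real.zero_rpow (by linarith : p ≠ 0), this]
  have ha' : 0 < |a| := abs_pos.2 ha
  have h1 := one_add_mul_self_le_rpow_one_add (s := |b| / |a| - 1)
    (by have : 0 ≤ |b| / |a| := by positivity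
        linarith) hp
  rw [add_sub_cancel, Real.div_rpow (abs_nonneg _) (abs_nonneg _),
    le_div_iff₀ (by positivity)] at h1
  have h2 : |a| ^ p = |a| ^ (p - 1) * |a| := by
    rw [← Real.rpow_add_one ha'.ne']; ring_nf
  have h3 : (1 + p * (|b| / |a| - 1)) * |a| ^ p =
      |a| ^ p + p * |a| ^ (p - 1) * (|b| - |a|) := by
    rw [h2]; field_simp
  have h4 : (SignType.sign a : ℝ) * (a - b) ≥ |a| - |b| := by
    rcases lt_or_gt_of_ne ha with h | h
    · rw [sign_neg h, abs_of_neg h]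
      have := neg_abs_le b
      have := le_abs_self b
      simp only [SignType.coe_neg, SignType.coe_one]; linarith
    · rw [sign_pos h, abs_of_pos h]
      have := le_abs_self b
      simp only [SignType.coe_one]; linarith
  have h5 : 0 ≤ p * |a| ^ (p - 1) := by positivity
  have h6 := mul_le_mul_of_nonneg_left h4 h5
  nlinarith

/-- Compare with the truncation at radius 1, which is controlled by the weighted integral of f. The
difference lives on ε < ‖h‖ ≤ 1, where symmetrization leaves ‖h‖^(σ - a), integrable because σ > a -
N. The bound is uniform in ε and serves as the majorant in the limit ε → 0. -/
lemma abs_truncOp_le_of_second_diff (hN : 1 ≤ N) {a σ r M A : ℝ} (ha : (N : ℝ) < a)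
    (hσ : a - N < σ) (hr : 0 ≤ r) (hA : 0 ≤ A)
    {f : EuclideanSpace ℝ (Fin N) → ℝ} (hf : Measurable f)
    (hfi : Integrable fun y => |f y| * (1 + ‖y‖) ^ (-a))
    (hM : ∀ x, ‖x‖ ≤ r → |f x| ≤ M)
    (hD : ∀ x h, ‖x‖ ≤ r → ‖h‖ ≤ 1 → |2 * f x - f (x + h) - f (x - h)| ≤ A * ‖h‖ ^ σ) :
    ∃ B, ∀ ε, 0 < ε → ε < 1 → ∀ x, ‖x‖ ≤ r → |truncOp a ε f x| ≤ B := by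
  have ha0 : 0 < a := (Nat.cast_nonneg N).trans_lt ha
  have hloc := (integrable_norm_rpow_of_le_one hN (b := σ - a) (by linarith)).const_mul A
  set κ := ∫ h : EuclideanSpace ℝ (Fin N), truncKernel a 1 h with hκ
  have hκ0 : 0 ≤ κ := integral_nonneg fun h => truncKernel_nonneg _ _ _
  set T := ∫ y, (1 + (1 + r) / 1) ^ a * (|f y| * (1 + ‖y‖) ^ (-a)) with hT
  set G := ∫ h : EuclideanSpace ℝ (Fin N), A * (if ‖h‖ ≤ 1 then ‖h‖ ^ (σ - a) else 0) with hG
  refine ⟨M * κ + T + 1 / 2 * G, fun ε hε hε1 x hx => ?_⟩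
  have h1 : |truncOp a 1 f x| ≤ M * κ + T := by
    rw [truncOp_eq ha one_pos hf hfi]
    refine (abs_sub _ _).trans (add_le_add ?_ ?_)
    · rw [abs_mul, abs_of_nonneg hκ0]
      exact mul_le_mul_of_nonneg_right (hM x hx) hκ0
    · refine (norm_integral_le_integral_norm _).trans
        (integral_mono (integrable_mul_truncKernel ha0 one_pos hf hfi x).norm
          (hfi.const_mul _) fun y => ?_)
      simp only [norm_mul, Real.norm_eq_abs, abs_of_nonneg (truncKernel_nonneg a 1 (x - y))]
      calc _ ≤ |f y| * ((1 + (1 + r) / 1) ^ a * (1 + ‖y‖) ^ (-a)) :=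
            mul_le_mul_of_nonneg_left (truncKernel_sub_le ha0 one_pos hr hx y) (abs_nonneg _)
        _ = _ := by ring
  obtain ⟨i1, e1⟩ := truncOp_eq_second_diff ha hε hf hfi x
  obtain ⟨i2, e2⟩ := truncOp_eq_second_diff ha one_pos hf hfi x
  have h2 : |truncOp a ε f x - truncOp a 1 f x| ≤ 1 / 2 * G := by
    rw [e1, e2, ← mul_sub, abs_mul, abs_of_pos (by norm_num : (0 : ℝ) < 1 / 2),
      ← integral_sub i1 i2]
    refine mul_le_mul_of_nonneg_left ?_ (by norm_num)
    refine (norm_integral_le_integral_norm _).trans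
      (integral_mono (i1.sub i2).norm hloc fun h => ?_)
    simp only [Pi.sub_apply, ← mul_sub, norm_mul, Real.norm_eq_abs]
    by_cases hh : ‖h‖ ≤ 1
    · rw [if_pos hh]
      have k1 : truncKernel a 1 h = 0 := by
        simp [truncKernel, not_lt.2 hh]
      rw [k1, sub_zero, abs_of_nonneg (truncKernel_nonneg _ _ _)]
      unfold truncKernel
      split_ifs with h3
      · have h0 : 0 < ‖h‖ := hε.trans h3
        calc _ ≤ A * ‖h‖ ^ σ * ‖h‖ ^ (-a) :=
              mul_le_mul_of_nonneg_right (hD x h hx hh) (by positivity)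
          _ = _ := by rw [mul_assoc, ← Real.rpow_add h0]; rfl
      · rw [mul_zero]; positivity
    · rw [if_neg hh]
      have h3 : 1 < ‖h‖ := not_le.1 hh
      have : truncKernel a ε h = truncKernel a 1 h := by
        simp [truncKernel, h3, hε1.trans h3]
      simp [this]
  have := abs_sub_abs_le_abs_sub (truncOp a ε f x) (truncOp a 1 f x)
  linarith

/-- Both regularity regimes give one estimate: σ = θ directly from Hölder continuity when s < 1/2,
and σ = 1 + θ when s ≥ 1/2, since the first-order terms at h and -h cancel. Balls of radius r + 1
are used so that x ± h stays inside. -/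
lemma FracRegular.second_diff {s : ℝ} (hs0 : 0 < s) {u : EuclideanSpace ℝ (Fin N) → ℝ}
    (hu : FracRegular s u) :
    Continuous u ∧ ∃ σ, 2 * s < σ ∧ ∀ r, ∃ A, 0 ≤ A ∧ ∀ x h, ‖x‖ ≤ r → ‖h‖ ≤ 1 →
      |2 * u x - u (x + h) - u (x - h)| ≤ A * ‖h‖ ^ σ := by
  have mem : ∀ {r : ℝ} {x h : EuclideanSpace ℝ (Fin N)}, ‖x‖ ≤ r → ‖h‖ ≤ 1 →
      x + h ∈ Metric.closedBall (0 : EuclideanSpace ℝ (Fin N)) (r + 1) := by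
    intro r x h hx hh
    rw [mem_closedBall_zero_iff]
    exact (norm_add_le _ _).trans (add_le_add hx hh)
  rcases lt_or_ge s (1 / 2) with hs | hs
  · obtain ⟨θ, hθ, -, hh⟩ := hu.1 hs
    have hθ0 : 0 < θ := by
      have : (0 : ℝ) < θ := by linarith
      exact_mod_cast this
    refine ⟨?_, θ, hθ, fun r => ?_⟩
    · rw [continuous_iff_continuousAt]
      intro x
      obtain ⟨C, hC⟩ := hh _ (isCompact_closedBall x 1)
      exact (hC.continuousOn hθ0).continuousAt (Metric.closedBall_mem_nhds x one_pos)
    · obtain ⟨C, hC⟩ := hh _ (isCompact_closedBall 0 (r + 1))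
      refine ⟨2 * C, by positivity, fun x h hx hh1 => ?_⟩
      have hx0 : x ∈ Metric.closedBall (0 : EuclideanSpace ℝ (Fin N)) (r + 1) := by
        simpa using mem hx (by simp : ‖(0 : EuclideanSpace ℝ (Fin N))‖ ≤ 1)
      have h1 := hC.dist_le hx0 (mem hx hh1)
      have h2 := hC.dist_le hx0 (mem (h := -h) hx (by simpa))
      rw [dist_self_add_right, Real.dist_eq] at h1
      rw [dist_self_add_right, Real.dist_eq, norm_neg, ← sub_eq_add_neg] at h2
      have : 2 * u x - u (x + h) - u (x - h) = (u x - u (x + h)) + (u x - u (x - h)) := by ring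
      rw [this]
      refine (abs_add_le _ _).trans ?_
      linarith
  · obtain ⟨hc, θ, hθ, -, hh⟩ := hu.2 hs
    refine ⟨hc.continuous, 1 + θ, by linarith, fun r => ?_⟩
    obtain ⟨C, hC⟩ := hh _ (isCompact_closedBall 0 (r + 1))
    have key : ∀ x h, ‖x‖ ≤ r → ‖h‖ ≤ 1 →
        |u (x + h) - u x - fderiv ℝ u x h| ≤ C * ‖h‖ ^ (1 + θ : ℝ) := by
      intro x h hx hh1
      have := Convex.norm_image_sub_le_of_norm_fderiv_le' (𝕜 := ℝ) (f := u)
        (s := Metric.closedBall x ‖h‖) (x := x) (y := x + h) (φ := fderiv ℝ u x)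
        (C := C * ‖h‖ ^ (θ : ℝ))
        (fun y _ => hc.differentiable one_ne_zero y) (fun y hy => ?_) (convex_closedBall _ _)
        (Metric.mem_closedBall_self (norm_nonneg _)) (by simp)
      · rw [add_sub_cancel_left, Real.norm_eq_abs] at this
        refine this.trans_eq ?_
        rcases eq_or_ne h 0 with rfl | h0
        · have : (1 + θ : ℝ) ≠ 0 := by positivity
          simp [Real.zero_rpow this]
        · rw [Real.rpow_add (norm_pos_iff.2 h0), Real.rpow_one]; ring
      · have hx0 : x ∈ Metric.closedBall (0 : EuclideanSpace ℝ (Fin N)) (r + 1) := by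
          simpa using mem hx (by simp : ‖(0 : EuclideanSpace ℝ (Fin N))‖ ≤ 1)
        have hyx : ‖y - x‖ ≤ ‖h‖ := by rwa [← dist_eq_norm]
        have hy0 := mem hx (hyx.trans hh1)
        rw [add_sub_cancel] at hy0
        have h1 := hC.dist_le hy0 hx0
        rw [dist_eq_norm, dist_eq_norm] at h1
        exact h1.trans (mul_le_mul_of_nonneg_left
          (Real.rpow_le_rpow (norm_nonneg _) hyx θ.2) C.2)
    refine ⟨2 * C, by positivity, fun x h hx hh1 => ?_⟩
    have h1 := key x h hx hh1
    have h2 := key x (-h) hx (by simpa)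
    rw [norm_neg, map_neg, ← sub_eq_add_neg] at h2
    rw [abs_le] at h1 h2 ⊢
    constructor <;> linarith

lemma rpow_one_add_le {a t : ℝ} (ha : 0 ≤ a) (ht : 0 ≤ t) :
    (1 + t) ^ (-a) ≤ 2 * (1 / (1 + t ^ a)) := by
  rw [Real.rpow_neg (by positivity), mul_one_div, inv_le_comm₀ (by positivity) (by positivity),
    inv_div, div_le_iff₀ two_pos]
  have h1 : 1 ≤ (1 + t) ^ a := Real.one_le_rpow (by linarith) ha
  have h2 : t ^ a ≤ (1 + t) ^ a := Real.rpow_le_rpow ht (by linarith) ha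
  linarith

lemma MemFracL.integrable {s : ℝ} (hs0 : 0 < s) {u : EuclideanSpace ℝ (Fin N) → ℝ}
    (hu : MemFracL s u) : Integrable fun y => |u y| * (1 + ‖y‖) ^ (-((N : ℝ) + 2 * s)) := by
  have hm := hu.1
  refine (hu.2.const_mul 2).mono' (Measurable.aestronglyMeasurable (by fun_prop))
    (ae_of_all _ fun y => ?_)
  rw [Real.norm_of_nonneg (by positivity)]
  calc _ ≤ |u y| * (2 * (1 / (1 + ‖y‖ ^ ((N : ℝ) + 2 * s)))) :=
        mul_le_mul_of_nonneg_left (rpow_one_add_le (by positivity) (norm_nonneg _)) (abs_nonneg _)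
    _ = _ := by ring

lemma fracLapConst_pos (N : ℕ) {s : ℝ} (hs0 : 0 < s) (hs1 : s < 1) : 0 < fracLapConst N s := by
  unfold fracLapConst
  have h1 : 0 < Real.Gamma (((N : ℝ) + 2 * s) / 2) := Real.Gamma_pos_of_pos (by positivity)
  have h2 : 0 < Real.Gamma (1 - s) := Real.Gamma_pos_of_pos (by linarith)
  have := Real.pi_pos
  positivity

/-- Weak form of `(-Δ)^s |u|^p + p V |u|^p ≤ 0`. -/
theorem integral_potential_le (hN : 1 ≤ N) {s p : ℝ} (hs0 : 0 < s) (hs1 : s < 1) (hp : 1 ≤ p)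
    {V u φ E : EuclideanSpace ℝ (Fin N) → ℝ} (huL : MemFracL s u) (hur : FracRegular s u)
    (hueq : ∀ x, HasFracLaplacianAt s u x (-(V x * u x)))
    (hwi : Integrable fun y => |u y| ^ p * (1 + ‖y‖) ^ (-(N : ℝ)))
    (hφ : Continuous φ) (hφc : HasCompactSupport φ) (hφ0 : ∀ x, 0 ≤ φ x)
    (hE : ∀ ε, 0 < ε → ε < 1 → ∀ x, -E x ≤ truncOp (N + 2 * s) ε φ x)
    (hEi : Integrable fun x => |u x| ^ p * E x) :
    p * ∫ x, V x * |u x| ^ p * φ x ≤ fracLapConst N s * ∫ x, |u x| ^ p * E x := by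
  have ha : (N : ℝ) < N + 2 * s := by linarith
  have ha0 : (0 : ℝ) < N + 2 * s := by positivity
  have hC := fracLapConst_pos N hs0 hs1
  set C := fracLapConst N s
  set a := (N : ℝ) + 2 * s with hadef
  obtain ⟨huc, σ, hσ, hA⟩ := hur.second_diff hs0
  have hum := huL.1
  have hui := huL.integrable hs0
  have hwc : Continuous fun x => |u x| ^ p := huc.abs.rpow_const fun _ => Or.inr (by linarith)
  have hwi' : Integrable fun y => |(|u y| ^ p)| * (1 + ‖y‖) ^ (-a) := by
    refine hwi.mono' (Measurable.aestronglyMeasurable (by fun_prop)) (ae_of_all _ fun y => ?_)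
    rw [Real.norm_of_nonneg (by positivity), abs_of_nonneg (by positivity)]
    exact mul_le_mul_of_nonneg_left (Real.rpow_le_rpow_of_exponent_le
      (by linarith [norm_nonneg y]) (by linarith)) (by positivity)
  obtain ⟨r, hr0, hr⟩ : ∃ r : ℝ, 0 ≤ r ∧ ∀ x, φ x ≠ 0 → ‖x‖ ≤ r := by
    obtain ⟨r, hr⟩ := hφc.isCompact.isBounded.exists_norm_le
    exact ⟨max r 0, le_max_right _ _, fun x hx =>
      (hr x (subset_tsupport _ hx)).trans (le_max_left _ _)⟩
  obtain ⟨M, hM⟩ := (isCompact_closedBall (0 : EuclideanSpace ℝ (Fin N)) r).exists_bound_of_continuousOn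
    huc.continuousOn
  have hM' : ∀ x, ‖x‖ ≤ r → |u x| ≤ M := fun x hx => hM x (by simpa using hx)
  obtain ⟨A, hA0, hD⟩ := hA r
  obtain ⟨B, hB⟩ := abs_truncOp_le_of_second_diff hN ha (by linarith : a - N < σ) hr0 hA0 hum hui
    hM' hD
  -- g is a subgradient of |t|^p evaluated at u, so that g u = p |u|^p.
  set g : EuclideanSpace ℝ (Fin N) → ℝ := fun x => p * |u x| ^ (p - 1) * SignType.sign (u x)
    with hg
  have hgm : Measurable g := by
    have h1 : Measurable fun x => ((SignType.sign (u x) : SignType) : ℝ) := by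
      have : (fun x => ((SignType.sign (u x) : SignType) : ℝ)) =
          fun x => if 0 < u x then 1 else if u x < 0 then -1 else 0 := by
        funext x
        rw [sign_apply]
        split_ifs <;> simp
      rw [this]
      exact Measurable.ite (measurableSet_lt measurable_const hum) measurable_const
        (Measurable.ite (measurableSet_lt hum measurable_const) measurable_const measurable_const)
    fun_prop
  have hgb : ∀ x, ‖g x‖ ≤ p * |u x| ^ (p - 1) := by
    intro x
    have h1 : |((SignType.sign (u x) : SignType) : ℝ)| ≤ 1 := by
      cases SignType.sign (u x) <;> simp
    rw [hg, Real.norm_eq_abs, abs_mul, abs_of_nonneg (by positivity)]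
    exact mul_le_of_le_one_right (by positivity) h1
  have hgu : ∀ x, g x * u x = p * |u x| ^ p := by
    intro x
    rcases eq_or_ne (u x) 0 with h | h
    · simp [h, Real.zero_rpow (by linarith : p ≠ 0)]
    · rw [hg]
      simp only
      rw [mul_assoc, sign_mul_self, mul_assoc, ← Real.rpow_add_one (abs_ne_zero.2 h)]
      ring_nf
  have hmeas : ∀ ε, AEStronglyMeasurable (fun x => φ x * (g x * (C * truncOp a ε u x))) volume :=
    fun ε => (hφ.measurable.mul
      (hgm.mul ((measurable_truncOp hum).measurable.const_mul C))).aestronglyMeasurable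
  have hbi : Integrable (fun x => φ x * (p * |u x| ^ (p - 1) * (C * B))) :=
    (hφ.mul ((continuous_const.mul (huc.abs.rpow_const fun _ => Or.inr (by linarith))).mul
      continuous_const)).integrable_of_hasCompactSupport hφc.mul_right
  have hbound : ∀ ε, 0 < ε → ε < 1 → ∀ x,
      ‖φ x * (g x * (C * truncOp a ε u x))‖ ≤ φ x * (p * |u x| ^ (p - 1) * (C * B)) := by
    intro ε hε hε1 x
    by_cases hx : φ x = 0
    · simp [hx]
    · rw [norm_mul (φ x), norm_mul (g x), norm_mul C, Real.norm_of_nonneg (hφ0 x),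
        Real.norm_of_nonneg hC.le]
      have h1 : ‖truncOp a ε u x‖ ≤ B := hB ε hε hε1 x (hr x hx)
      have h2 := hφ0 x
      have h3 := hgb x
      gcongr
  have hlim : Tendsto (fun ε => ∫ x, φ x * (g x * (C * truncOp a ε u x))) (𝓝[>] 0)
      (𝓝 (∫ x, φ x * (g x * -(V x * u x)))) := by
    refine tendsto_integral_filter_of_dominated_convergence _ (Eventually.of_forall hmeas) ?_ hbi
      (ae_of_all _ fun x =>
        (((hasFracLaplacianAt_iff_truncOp u x _).1 (hueq x)).const_mul (g x)).const_mul (φ x))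
    filter_upwards [Ioo_mem_nhdsGT (zero_lt_one (α := ℝ))] with ε hε
    exact ae_of_all _ (hbound ε hε.1 hε.2)
  have hge : ∀ ε, 0 < ε → ε < 1 →
      -(C * ∫ x, |u x| ^ p * E x) ≤ ∫ x, φ x * (g x * (C * truncOp a ε u x)) := by
    intro ε hε hε1
    obtain ⟨i1, i2, e⟩ := integral_mul_truncOp_comm ha hε hφ hφc hwc hwi'
    have h1 : -(∫ x, |u x| ^ p * E x) ≤ ∫ x, |u x| ^ p * truncOp a ε φ x := by
      rw [← integral_neg]
      refine integral_mono hEi.neg i2 fun x => ?_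
      have := mul_le_mul_of_nonneg_left (hE ε hε hε1 x) (by positivity : 0 ≤ |u x| ^ p)
      simp only; linarith
    -- The kernel is nonnegative, so the subgradient inequality integrates pointwise at each fixed
    -- ε, with no regularity of |u|^p needed.
    have h2 : ∀ x, truncOp a ε (fun x => |u x| ^ p) x ≤ g x * truncOp a ε u x := by
      intro x
      unfold truncOp
      rw [← integral_const_mul]
      refine integral_mono (integrable_diff_mul_truncKernel ha hε hwc.measurable hwi' x _)
        ((integrable_diff_mul_truncKernel ha hε hum hui x _).const_mul _) fun y => ?_
      simp only
      rw [← mul_assoc]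
      exact mul_le_mul_of_nonneg_right (abs_rpow_tangent_le hp _ _) (truncKernel_nonneg _ _ _)
    have h3 : ∫ x, φ x * (C * truncOp a ε (fun x => |u x| ^ p) x) ≤
        ∫ x, φ x * (g x * (C * truncOp a ε u x)) := by
      refine integral_mono ?_ ?_ fun x => ?_
      · convert i1.const_mul C using 2; ring
      · exact hbi.mono' (hmeas ε) (ae_of_all _ (hbound ε hε hε1))
      · have := mul_le_mul_of_nonneg_left (h2 x) hC.le
        refine mul_le_mul_of_nonneg_left (this.trans_eq (by ring)) (hφ0 x)
    have h4 : ∫ x, φ x * (C * truncOp a ε (fun x => |u x| ^ p) x) =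
        C * ∫ x, |u x| ^ p * truncOp a ε φ x := by
      rw [← e, ← integral_const_mul]; congr 1; funext x; ring
    rw [h4] at h3
    have := mul_le_mul_of_nonneg_left h1 hC.le
    linarith
  have h := ge_of_tendsto hlim (b := -(C * ∫ x, |u x| ^ p * E x)) (by
    filter_upwards [Ioo_mem_nhdsGT (zero_lt_one (α := ℝ))] with ε hε using hge ε hε.1 hε.2)
  have e : ∫ x, φ x * (g x * -(V x * u x)) = -(p * ∫ x, V x * |u x| ^ p * φ x) := by
    rw [← integral_const_mul, ← integral_neg]
    congr 1; funext x
    linear_combination (-φ x * V x) * hgu x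
  rw [e] at h
  linarith

end Weak

/-! ### The Liouville criterion, and the case N ≤ 2s. -/

section Recurrent

variable {N : ℕ}

/-- Liouville criterion: `u` vanishes as soon as there are test functions on which the truncated
operators are bounded below by errors that vanish in the limit. -/
theorem eq_zero_of_test_functions (hN : 1 ≤ N) {s p : ℝ} (hs0 : 0 < s) (hs1 : s < 1) (hp : 1 ≤ p)
    {V u : EuclideanSpace ℝ (Fin N) → ℝ} (hV : Continuous V) (hV0 : ∀ x, 0 < V x)
    (huL : MemFracL s u) (hur : FracRegular s u)
    (hueq : ∀ x, HasFracLaplacianAt s u x (-(V x * u x)))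
    (hwi : Integrable fun y => |u y| ^ p * (1 + ‖y‖) ^ (-(N : ℝ)))
    {φ E : ℕ → EuclideanSpace ℝ (Fin N) → ℝ} {C : ℝ} (hφ : ∀ n, Continuous (φ n))
    (hφc : ∀ n, HasCompactSupport (φ n)) (hφ0 : ∀ n x, 0 ≤ φ n x) (hφm : Monotone φ)
    (hφp : ∀ x, ∃ n, φ n x ≠ 0)
    (hφE : ∀ n ε, 0 < ε → ε < 1 → ∀ x, -E n x ≤ truncOp (N + 2 * s) ε (φ n) x)
    (hEm : ∀ n, Measurable (E n)) (hEb : ∀ n x, |E n x| ≤ C * (1 + ‖x‖) ^ (-(N : ℝ)))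
    (hE : ∀ x, Tendsto (fun n => E n x) atTop (𝓝 0)) (x : EuclideanSpace ℝ (Fin N)) :
    u x = 0 := by
  by_contra hx
  obtain ⟨n₀, hn₀⟩ := hφp x
  have huc := (hur.second_diff hs0).1
  have hwc : Continuous fun x => |u x| ^ p := huc.abs.rpow_const fun _ => Or.inr (by linarith)
  have hint : ∀ n, Integrable fun x => V x * |u x| ^ p * φ n x := fun n =>
    ((hV.mul hwc).mul (hφ n)).integrable_of_hasCompactSupport (hφc n).mul_left
  have hpos : 0 < ∫ x, V x * |u x| ^ p * φ n₀ x := by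
    refine Continuous.integral_pos_of_hasCompactSupport_nonneg_nonzero (x := x)
      ((hV.mul hwc).mul (hφ n₀)) (hφc n₀).mul_left (fun y => ?_) ?_
    · have := hV0 y
      have := hφ0 n₀ y
      simp only [Pi.zero_apply]; positivity
    · have h1 : 0 < |u x| := abs_pos.2 hx
      have := hV0 x
      exact mul_ne_zero (by positivity) hn₀
  have hb : ∀ n x, ‖|u x| ^ p * E n x‖ ≤ C * (|u x| ^ p * (1 + ‖x‖) ^ (-(N : ℝ))) := by
    intro n x
    rw [norm_mul, Real.norm_of_nonneg (by positivity : 0 ≤ |u x| ^ p)]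
    exact (mul_le_mul_of_nonneg_left (hEb n x) (by positivity)).trans_eq (by ring)
  have hm : ∀ n, AEStronglyMeasurable (fun x => |u x| ^ p * E n x) volume := fun n =>
    (hwc.measurable.mul (hEm n)).aestronglyMeasurable
  have hlim : Tendsto (fun n => fracLapConst N s * ∫ x, |u x| ^ p * E n x) atTop (𝓝 0) := by
    have := tendsto_integral_filter_of_dominated_convergence (l := atTop)
      (F := fun n x => |u x| ^ p * E n x) (f := fun _ => (0 : ℝ)) (μ := volume) _
      (Eventually.of_forall hm) (Eventually.of_forall fun n => ae_of_all _ (hb n))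
      (hwi.const_mul C) (ae_of_all _ fun x => by simpa using (hE x).const_mul (|u x| ^ p))
    simpa using this.const_mul (fracLapConst N s)
  -- By monotonicity in n, the integral for the fixed index n₀ is bounded by those for all n ≥ n₀,
  -- hence by a quantity tending to 0.
  have hle : p * ∫ x, V x * |u x| ^ p * φ n₀ x ≤ 0 := by
    refine ge_of_tendsto hlim ?_
    filter_upwards [eventually_ge_atTop n₀] with n hn
    refine le_trans ?_ (integral_potential_le hN hs0 hs1 hp huL hur hueq hwi (hφ n) (hφc n)
      (hφ0 n) (hφE n) ((hwi.const_mul C).mono' (hm n) (ae_of_all _ (hb n))))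
    refine mul_le_mul_of_nonneg_left (integral_mono (hint n₀) (hint n) fun y => ?_) (by linarith)
    have := (hV0 y).le
    exact mul_le_mul_of_nonneg_left (hφm hn y) (by positivity)
  nlinarith

lemma truncKernel_smul {a ε c : ℝ} (hc : 0 < c) (z : EuclideanSpace ℝ (Fin N)) :
    truncKernel a ε z = c ^ a * truncKernel a (c * ε) (c • z) := by
  unfold truncKernel
  rw [norm_smul, Real.norm_of_nonneg hc.le]
  simp only [mul_lt_mul_iff_right₀ hc]
  split_ifs
  · rw [Real.mul_rpow hc.le (norm_nonneg _), ← mul_assoc, ← Real.rpow_add hc]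
    simp
  · simp

/-- Dilation also rescales the truncation radius, which is why the bounds for the unit bump are
proved for all ε > 0. -/
lemma truncOp_comp_smul {a ε c : ℝ} (hc : 0 < c) (f : EuclideanSpace ℝ (Fin N) → ℝ)
    (x : EuclideanSpace ℝ (Fin N)) :
    truncOp a ε (fun y => f (c • y)) x = c ^ (a - N) * truncOp a (c * ε) f (c • x) := by
  unfold truncOp
  have h : ∀ y, (f (c • x) - f (c • y)) * truncKernel a ε (x - y) =
      c ^ a * ((f (c • x) - f (c • y)) * truncKernel a (c * ε) (c • x - c • y)) := by
    intro y
    rw [truncKernel_smul hc, smul_sub]; ring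
  simp_rw [h]
  rw [integral_const_mul, Measure.integral_comp_smul volume
    (fun y => (f (c • x) - f y) * truncKernel a (c * ε) (c • x - y)) c, finrank_euclideanSpace,
    Fintype.card_fin, abs_of_pos (by positivity), smul_eq_mul, ← mul_assoc, Real.rpow_sub hc,
    Real.rpow_natCast, div_eq_mul_inv]

/-- The bump function `(1 - ‖x‖²)₊²`. -/
def quarticBump (x : EuclideanSpace ℝ (Fin N)) : ℝ := max (1 - ‖x‖ ^ 2) 0 ^ 2

lemma quarticBump_nonneg (x : EuclideanSpace ℝ (Fin N)) : 0 ≤ quarticBump x := sq_nonneg _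

lemma quarticBump_le_one (x : EuclideanSpace ℝ (Fin N)) : quarticBump x ≤ 1 := by
  refine pow_le_one₀ (le_max_right _ _) (max_le ?_ zero_le_one)
  linarith [sq_nonneg ‖x‖]

lemma continuous_quarticBump :
    Continuous (quarticBump : EuclideanSpace ℝ (Fin N) → ℝ) := by
  unfold quarticBump; fun_prop

lemma quarticBump_eq_zero {x : EuclideanSpace ℝ (Fin N)} (hx : 1 ≤ ‖x‖) : quarticBump x = 0 := by
  have : 1 - ‖x‖ ^ 2 ≤ 0 := by nlinarith
  simp [quarticBump, max_eq_right this]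

lemma hasCompactSupport_quarticBump :
    HasCompactSupport (quarticBump : EuclideanSpace ℝ (Fin N) → ℝ) := by
  refine HasCompactSupport.of_support_subset_isCompact (isCompact_closedBall 0 1) fun x hx => ?_
  by_contra h
  rw [mem_closedBall_zero_iff, not_le] at h
  exact hx (quarticBump_eq_zero h.le)

/-- The function t₊² is C^{1,1} with second derivative at most 2; this is its quadratic upper Taylor
bound. It is the reason for squaring in `quarticBump`. -/
lemma posPart_sq_le (t b : ℝ) :
    max b 0 ^ 2 ≤ max t 0 ^ 2 + 2 * max t 0 * (b - t) + (b - t) ^ 2 := by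
  rcases le_total t 0 with ht | ht <;> rcases le_total b 0 with hb | hb <;>
    simp only [max_eq_left, max_eq_right, ht, hb] <;> nlinarith [sq_nonneg b, sq_nonneg (b - t)]

/-- In the Taylor bounds at x ± h, the linear terms add up, by the parallelogram law, to a quantity
of favourable sign. Each quadratic remainder is at most (5‖h‖)², because ‖x‖ + ‖x ± h‖ ≤ 2 + 2 + 1.
-/
lemma neg_le_second_diff_quarticBump {x h : EuclideanSpace ℝ (Fin N)} (hx : ‖x‖ ≤ 2)
    (hh : ‖h‖ ≤ 1) :
    -(50 * ‖h‖ ^ 2) ≤ 2 * quarticBump x - quarticBump (x + h) - quarticBump (x - h) := by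
  unfold quarticBump
  have h1 := posPart_sq_le (1 - ‖x‖ ^ 2) (1 - ‖x + h‖ ^ 2)
  have h2 := posPart_sq_le (1 - ‖x‖ ^ 2) (1 - ‖x - h‖ ^ 2)
  have h3 := parallelogram_law_with_norm ℝ x h
  have h0 : 0 ≤ max (1 - ‖x‖ ^ 2) 0 := le_max_right _ _
  have key : ∀ z : ℝ, |‖x‖ - z| ≤ ‖h‖ → 0 ≤ z → (‖x‖ ^ 2 - z ^ 2) ^ 2 ≤ 25 * ‖h‖ ^ 2 := by
    intro z hz hz0
    have e : ‖x‖ ^ 2 - z ^ 2 = (‖x‖ - z) * (‖x‖ + z) := by ring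
    have hz1 : z ≤ ‖x‖ + ‖h‖ := by linarith [neg_abs_le (‖x‖ - z)]
    have h5 : ‖x‖ + z ≤ 5 := by linarith
    have h6 : 0 ≤ ‖x‖ + z := by positivity
    rw [e, mul_pow, ← sq_abs (‖x‖ - z), mul_comm (25 : ℝ)]
    have := pow_le_pow_left₀ (abs_nonneg _) hz 2
    have := pow_le_pow_left₀ h6 h5 2
    calc _ ≤ ‖h‖ ^ 2 * 5 ^ 2 := by gcongr
      _ = _ := by norm_num
  have h4 := key ‖x + h‖ (by simpa using abs_norm_sub_norm_le x (x + h)) (norm_nonneg _)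
  have h5 := key ‖x - h‖ (by simpa using abs_norm_sub_norm_le x (x - h)) (norm_nonneg _)
  have h6 : 0 ≤ max (1 - ‖x‖ ^ 2) 0 * (‖h‖ * ‖h‖) := by positivity
  have h7 : max (1 - ‖x‖ ^ 2) 0 * (1 - ‖x + h‖ ^ 2 - (1 - ‖x‖ ^ 2)) +
      max (1 - ‖x‖ ^ 2) 0 * (1 - ‖x - h‖ ^ 2 - (1 - ‖x‖ ^ 2)) =
      -2 * (max (1 - ‖x‖ ^ 2) 0 * (‖h‖ * ‖h‖)) := by
    linear_combination (-max (1 - ‖x‖ ^ 2) 0) * h3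
  nlinarith

lemma integrable_quarticBump_weight (a : ℝ) :
    Integrable fun y : EuclideanSpace ℝ (Fin N) => |quarticBump y| * (1 + ‖y‖) ^ (-a) := by
  refine Continuous.integrable_of_hasCompactSupport ?_
    (hasCompactSupport_quarticBump.comp_left (g := abs) abs_zero).mul_right
  exact continuous_quarticBump.abs.mul
    (Continuous.rpow_const (by fun_prop) fun y => Or.inl (by positivity))

/-- For ‖h‖ ≤ 1 the quadratic bound makes the singularity ‖h‖^(2 - a), integrable since a < N + 2.
For ‖h‖ > 1 the bounds 0 ≤ η ≤ 1 on the bump suffice. -/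
lemma neg_le_truncOp_quarticBump_near (hN : 1 ≤ N) {a : ℝ} (ha : (N : ℝ) < a) (ha2 : a < N + 2) :
    ∃ C, 0 ≤ C ∧ ∀ ε, 0 < ε → ∀ x : EuclideanSpace ℝ (Fin N), ‖x‖ ≤ 2 →
      -C ≤ truncOp a ε quarticBump x := by
  have hmaj : Integrable fun h : EuclideanSpace ℝ (Fin N) =>
      50 * (if ‖h‖ ≤ 1 then ‖h‖ ^ (2 - a) else 0) + 2 * truncKernel a 1 h :=
    ((integrable_norm_rpow_of_le_one hN (by linarith)).const_mul 50).add
      ((integrable_truncKernel ha one_pos).const_mul 2)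
  refine ⟨1 / 2 * ∫ h : EuclideanSpace ℝ (Fin N),
    50 * (if ‖h‖ ≤ 1 then ‖h‖ ^ (2 - a) else 0) + 2 * truncKernel a 1 h, ?_, fun ε hε x hx => ?_⟩
  · refine mul_nonneg (by norm_num) (integral_nonneg fun h => ?_)
    have := truncKernel_nonneg a 1 h
    have : (0 : ℝ) ≤ if ‖h‖ ≤ 1 then ‖h‖ ^ (2 - a) else 0 := by split_ifs <;> positivity
    simp only [Pi.zero_apply]; positivity
  obtain ⟨i, e⟩ := truncOp_eq_second_diff ha hε continuous_quarticBump.measurable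
    (integrable_quarticBump_weight a) x
  rw [e, ← mul_neg, ← integral_neg]
  refine mul_le_mul_of_nonneg_left (integral_mono hmaj.neg i fun h => ?_) (by norm_num)
  simp only
  by_cases hh : ‖h‖ ≤ 1
  · have k1 : truncKernel a 1 h = 0 := by simp [truncKernel, not_lt.2 hh]
    rw [k1, if_pos hh, mul_zero, add_zero]
    unfold truncKernel
    split_ifs with h3
    · have h0 : 0 < ‖h‖ := hε.trans h3
      have := mul_le_mul_of_nonneg_right (neg_le_second_diff_quarticBump hx hh)
        (by positivity : 0 ≤ ‖h‖ ^ (-a))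
      refine le_trans (le_of_eq ?_) this
      rw [sub_eq_add_neg, Real.rpow_add h0, Real.rpow_two]; ring
    · rw [mul_zero]
      have : 0 ≤ ‖h‖ ^ (2 - a) := by positivity
      linarith
  · rw [if_neg hh, mul_zero, zero_add]
    have h3 : 1 < ‖h‖ := not_le.1 hh
    have h4 : truncKernel a ε h ≤ truncKernel a 1 h := by
      unfold truncKernel
      rw [if_pos h3]
      split_ifs
      · exact le_rfl
      · positivity
    have h5 : -2 ≤ 2 * quarticBump x - quarticBump (x + h) - quarticBump (x - h) := by
      linarith [quarticBump_nonneg x, quarticBump_le_one (x + h), quarticBump_le_one (x - h)]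
    have h6 := mul_le_mul_of_nonneg_right h5 (truncKernel_nonneg a ε h)
    linarith

/-- The bump vanishes at x, so only its mass seen from x contributes, at distance at least ‖x‖/2. -/
lemma neg_le_truncOp_quarticBump_far {a : ℝ} (ha : (N : ℝ) < a) :
    ∃ C, 0 ≤ C ∧ ∀ ε, 0 < ε → ∀ x : EuclideanSpace ℝ (Fin N), 2 ≤ ‖x‖ →
      -(C * ‖x‖ ^ (-a)) ≤ truncOp a ε quarticBump x := by
  have ha0 : 0 < a := (Nat.cast_nonneg N).trans_lt ha
  have hη : Integrable (quarticBump : EuclideanSpace ℝ (Fin N) → ℝ) :=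
    continuous_quarticBump.integrable_of_hasCompactSupport hasCompactSupport_quarticBump
  refine ⟨(∫ x : EuclideanSpace ℝ (Fin N), quarticBump x) * 2 ^ a,
    mul_nonneg (integral_nonneg quarticBump_nonneg) (by positivity), fun ε hε x hx => ?_⟩
  have hx0 : 0 < ‖x‖ := by linarith
  unfold truncOp
  rw [quarticBump_eq_zero (by linarith : 1 ≤ ‖x‖), mul_assoc, ← integral_mul_const,
    ← integral_neg]
  refine integral_mono (hη.mul_const _).neg
    (integrable_diff_mul_truncKernel ha hε continuous_quarticBump.measurable
      (integrable_quarticBump_weight a) x 0) fun y => ?_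
  simp only [zero_sub, neg_mul, neg_le_neg_iff]
  rcases le_total 1 ‖y‖ with hy | hy
  · rw [quarticBump_eq_zero hy]; simp
  · refine mul_le_mul_of_nonneg_left ?_ (quarticBump_nonneg y)
    unfold truncKernel
    split_ifs
    · have h3 : ‖x‖ / 2 ≤ ‖x - y‖ := by
        have := norm_sub_norm_le x y; linarith
      calc _ ≤ (‖x‖ / 2) ^ (-a) :=
            Real.rpow_le_rpow_of_nonpos (by positivity) h3 (by linarith)
        _ = _ := by
          rw [Real.div_rpow hx0.le zero_le_two, Real.rpow_neg zero_le_two, div_inv_eq_mul,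
            mul_comm]
    · positivity

/-- The decay is deliberately weakened from N + 2s to 2s: dilation by n + 1 then turns the bound
into exactly max(n + 1, ‖x‖)^(-2s). -/
lemma neg_le_truncOp_quarticBump (hN : 1 ≤ N) {s : ℝ} (hs0 : 0 < s) (hs1 : s < 1) :
    ∃ C, 0 ≤ C ∧ ∀ ε, 0 < ε → ∀ x : EuclideanSpace ℝ (Fin N),
      -(C * (max 1 ‖x‖) ^ (-(2 * s))) ≤ truncOp (N + 2 * s) ε quarticBump x := by
  have ha : (N : ℝ) < N + 2 * s := by linarith
  obtain ⟨B, hB0, hB⟩ := neg_le_truncOp_quarticBump_near hN ha (by linarith)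
  obtain ⟨I, hI0, hI⟩ := neg_le_truncOp_quarticBump_far ha
  refine ⟨B * 2 ^ (2 * s) + I, by positivity, fun ε hε x => ?_⟩
  have hm1 : 1 ≤ max 1 ‖x‖ := le_max_left _ _
  have hm0 : 0 < max 1 ‖x‖ := by linarith
  rw [add_mul, neg_add]
  rcases le_total ‖x‖ 2 with hx | hx
  · have h2 : 1 ≤ 2 ^ (2 * s) * (max 1 ‖x‖) ^ (-(2 * s)) := by
      rw [Real.rpow_neg hm0.le, ← div_eq_mul_inv, one_le_div (by positivity)]
      exact Real.rpow_le_rpow hm0.le (max_le (by norm_num) hx) (by linarith)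
    have h3 : 0 ≤ I * (max 1 ‖x‖) ^ (-(2 * s)) := by positivity
    have h4 := mul_le_mul_of_nonneg_left h2 hB0
    linarith [hB ε hε x hx]
  · have h2 : ‖x‖ ^ (-(N + 2 * s)) ≤ (max 1 ‖x‖) ^ (-(2 * s)) := by
      rw [max_eq_right (by linarith : 1 ≤ ‖x‖)]
      exact Real.rpow_le_rpow_of_exponent_le (by linarith)
        (by linarith [(Nat.cast_nonneg N : (0 : ℝ) ≤ N)])
    have h3 : 0 ≤ B * 2 ^ (2 * s) * (max 1 ‖x‖) ^ (-(2 * s)) := by positivity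
    have h4 := mul_le_mul_of_nonneg_left h2 hI0
    linarith [hI ε hε x hx]

lemma max_one_norm_rpow_le (x : EuclideanSpace ℝ (Fin N)) :
    (max 1 ‖x‖) ^ (-(N : ℝ)) ≤ 2 ^ (N : ℝ) * (1 + ‖x‖) ^ (-(N : ℝ)) := by
  have h1 : (1 + ‖x‖) / 2 ≤ max 1 ‖x‖ := by
    linarith [le_max_left 1 ‖x‖, le_max_right 1 ‖x‖]
  calc _ ≤ ((1 + ‖x‖) / 2) ^ (-(N : ℝ)) :=
        Real.rpow_le_rpow_of_nonpos (by positivity) h1 (by simp)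
    _ = _ := by
      rw [Real.div_rpow (by positivity) zero_le_two, Real.rpow_neg zero_le_two, div_inv_eq_mul,
        mul_comm]

/-- The condition N ≤ 2s is used to dominate max(1, ‖y‖)^(-2s) by the integrable weight of order (1
+ ‖y‖)^(-N). -/
theorem eq_zero_of_le_two_mul (hN : 1 ≤ N) {s p : ℝ} (hs0 : 0 < s) (hs1 : s < 1) (hp : 1 ≤ p)
    (hNs : (N : ℝ) ≤ 2 * s)
    {V u : EuclideanSpace ℝ (Fin N) → ℝ} (hV : Continuous V) (hV0 : ∀ x, 0 < V x)
    (huL : MemFracL s u) (hur : FracRegular s u)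
    (hueq : ∀ x, HasFracLaplacianAt s u x (-(V x * u x)))
    (hwi : Integrable fun y => |u y| ^ p * (1 + ‖y‖) ^ (-(N : ℝ)))
    (x : EuclideanSpace ℝ (Fin N)) : u x = 0 := by
  obtain ⟨C, hC0, hC⟩ := neg_le_truncOp_quarticBump hN hs0 hs1
  refine eq_zero_of_test_functions hN hs0 hs1 hp hV hV0 huL hur hueq hwi
    (φ := fun n y => quarticBump (((n : ℝ) + 1)⁻¹ • y))
    (E := fun n y => C * (max ((n : ℝ) + 1) ‖y‖) ^ (-(2 * s))) (C := C * 2 ^ (N : ℝ))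
    (fun n => continuous_quarticBump.comp (by fun_prop)) (fun n => ?_)
    (fun n y => quarticBump_nonneg _) (fun n k hnk y => ?_) (fun y => ?_)
    (fun n ε hε hε1 y => ?_) (fun n => by fun_prop) (fun n y => ?_) (fun y => ?_) x
  · exact hasCompactSupport_quarticBump.comp_smul (by positivity)
  · have h : (n : ℝ) ≤ k := by exact_mod_cast hnk
    simp only [quarticBump, norm_smul]
    refine pow_le_pow_left₀ (le_max_right _ _) (max_le_max_right _ ?_) 2
    rw [Real.norm_of_nonneg (by positivity), Real.norm_of_nonneg (by positivity)]
    gcongr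
  · obtain ⟨n, hn⟩ := exists_nat_gt ‖y‖
    refine ⟨n, ?_⟩
    have h1 : ‖((n : ℝ) + 1)⁻¹ • y‖ < 1 := by
      rw [norm_smul, Real.norm_of_nonneg (by positivity), inv_mul_lt_iff₀ (by positivity)]
      linarith
    have h2 : 0 < 1 - ‖((n : ℝ) + 1)⁻¹ • y‖ ^ 2 := by
      nlinarith [norm_nonneg (((n : ℝ) + 1)⁻¹ • y)]
    simp only [quarticBump]
    exact pow_ne_zero _ (lt_max_of_lt_left h2).ne'
  · have hn : (0 : ℝ) < (n : ℝ) + 1 := by positivity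
    rw [truncOp_comp_smul (inv_pos.2 hn), add_sub_cancel_left]
    have h1 := hC (((n : ℝ) + 1)⁻¹ * ε) (by positivity) (((n : ℝ) + 1)⁻¹ • y)
    have h2 := mul_le_mul_of_nonneg_left h1 (by positivity : 0 ≤ (((n : ℝ) + 1)⁻¹) ^ (2 * s))
    refine le_trans (le_of_eq ?_) h2
    rw [norm_smul, Real.norm_of_nonneg (by positivity), Real.inv_rpow hn.le,
      ← Real.rpow_neg hn.le]
    have h3 : max ((n : ℝ) + 1) ‖y‖ = ((n : ℝ) + 1) * max 1 (((n : ℝ) + 1)⁻¹ * ‖y‖) := by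
      rw [mul_max_of_nonneg _ _ hn.le]; field_simp
    rw [h3, Real.mul_rpow hn.le (le_max_of_le_left zero_le_one)]
    ring
  · have h0 : 1 ≤ max 1 ‖y‖ := le_max_left _ _
    rw [abs_of_nonneg (by positivity), mul_assoc]
    refine mul_le_mul_of_nonneg_left (le_trans ?_ (max_one_norm_rpow_le y)) hC0
    calc _ ≤ (max 1 ‖y‖) ^ (-(2 * s)) := by
          refine Real.rpow_le_rpow_of_nonpos (by positivity) (max_le_max_right _ ?_) (by linarith)
          linarith [(Nat.cast_nonneg n : (0 : ℝ) ≤ n)]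
      _ ≤ _ := Real.rpow_le_rpow_of_exponent_le h0 (by linarith)
  · have h1 : Tendsto (fun n : ℕ => max ((n : ℝ) + 1) ‖y‖) atTop atTop :=
      tendsto_atTop_mono (fun n => (by linarith [le_max_left ((n : ℝ) + 1) ‖y‖] :
        (n : ℝ) ≤ _)) tendsto_natCast_atTop_atTop
    simpa using ((tendsto_rpow_neg_atTop (by linarith : 0 < 2 * s)).comp h1).const_mul C

end Recurrent

/-! ### The case N > 2s: superharmonicity of the fundamental solution by inversion. -/

section Transient

variable {N : ℕ}

lemma ae_ne_zero (hN : 1 ≤ N) : ∀ᵐ y : EuclideanSpace ℝ (Fin N), y ≠ 0 := by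
  have : Nonempty (Fin N) := ⟨⟨0, hN⟩⟩
  exact compl_mem_ae_iff.2 (measure_singleton _)

/-- Change of variables under the inversion in the sphere of radius `R` around the origin. -/
lemma integral_comp_inversion (hN : 1 ≤ N) {R : ℝ} (hR : R ≠ 0)
    (g : EuclideanSpace ℝ (Fin N) → ℝ) :
    ∫ y, ((R / ‖y‖) ^ 2) ^ N * g (EuclideanGeometry.inversion 0 R y) = ∫ y, g y := by
  have himg : EuclideanGeometry.inversion (0 : EuclideanSpace ℝ (Fin N)) R '' {0}ᶜ = {0}ᶜ := by
    ext y
    simp only [Set.mem_image, Set.mem_compl_iff, Set.mem_singleton_iff]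
    constructor
    · rintro ⟨z, hz, rfl⟩ h
      exact hz ((EuclideanGeometry.inversion_eq_center hR).1 h)
    · intro hy
      exact ⟨_, fun h => hy ((EuclideanGeometry.inversion_eq_center hR).1 h),
        EuclideanGeometry.inversion_inversion 0 hR y⟩
  have h := integral_image_eq_integral_abs_det_fderiv_smul volume
    (measurableSet_singleton (0 : EuclideanSpace ℝ (Fin N))).compl
    (fun x hx => (EuclideanGeometry.hasFDerivAt_inversion (R := R) hx).hasFDerivWithinAt)
    (EuclideanGeometry.inversion_injective 0 hR).injOn g
  have hae : ∀ᵐ y : EuclideanSpace ℝ (Fin N), y ∈ ({0}ᶜ : Set (EuclideanSpace ℝ (Fin N))) :=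
    ae_ne_zero hN
  rw [himg, Measure.restrict_eq_self_of_ae_mem hae] at h
  rw [h]
  refine integral_congr_ae (ae_of_all _ fun y => ?_)
  simp only [smul_eq_mul, sub_zero, dist_zero_right]
  congr 1
  -- The derivative of the inversion is (R/‖y‖)² times a reflection, so its Jacobian is
  -- (R/‖y‖)^(2N).
  have hdet : ∀ (c : ℝ) (L : EuclideanSpace ℝ (Fin N) →L[ℝ] EuclideanSpace ℝ (Fin N)),
      (c • L).det = c ^ N * L.det := by
    intro c L
    simp [ContinuousLinearMap.det]
  rw [hdet, abs_mul, abs_of_nonneg (by positivity)]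
  have := Submodule.det_reflection (𝕜 := ℝ) (ℝ ∙ y)ᗮ
  have h2 : |((ℝ ∙ y)ᗮ.reflection : EuclideanSpace ℝ (Fin N) →L[ℝ] EuclideanSpace ℝ (Fin N)).det|
      = 1 := by
    unfold ContinuousLinearMap.det
    erw [this]
    simp
  rw [h2, mul_one]

/-- The truncation `‖x - y‖² ‖x‖ > ε² ‖y‖` is invariant under the inversion in the sphere through
`x`, which changes the sign of the integral below. -/
lemma integral_inversion_invariant_eq_zero (hN : 1 ≤ N) {a γ ε : ℝ} (haγ : a + γ = 2 * N)
    {x : EuclideanSpace ℝ (Fin N)} (hx : x ≠ 0) :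
    ∫ y, (if ε ^ 2 * ‖y‖ < ‖x - y‖ ^ 2 * ‖x‖ then
      (‖x‖ ^ (-γ) - ‖y‖ ^ (-γ)) * ‖x - y‖ ^ (-a) else 0) = 0 := by
  set f : EuclideanSpace ℝ (Fin N) → ℝ := fun y => if ε ^ 2 * ‖y‖ < ‖x - y‖ ^ 2 * ‖x‖ then
      (‖x‖ ^ (-γ) - ‖y‖ ^ (-γ)) * ‖x - y‖ ^ (-a) else 0 with hf
  have hR : 0 < ‖x‖ := norm_pos_iff.2 hx
  have h := integral_comp_inversion hN hR.ne' f
  have h2 : ∫ y, ((‖x‖ / ‖y‖) ^ 2) ^ N * f (EuclideanGeometry.inversion 0 ‖x‖ y) =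
      ∫ y, -f y := by
    refine integral_congr_ae ?_
    filter_upwards [ae_ne_zero hN] with y hy
    have hρ : 0 < ‖y‖ := norm_pos_iff.2 hy
    have e1 : ‖EuclideanGeometry.inversion 0 ‖x‖ y‖ = ‖x‖ * (‖x‖ / ‖y‖) := by
      have := EuclideanGeometry.dist_inversion_center 0 y ‖x‖
      rw [dist_zero_right, dist_zero_right] at this
      rw [this]; ring
    have e2 : ‖x - EuclideanGeometry.inversion 0 ‖x‖ y‖ = ‖x - y‖ * (‖x‖ / ‖y‖) := by
      have h3 := EuclideanGeometry.dist_inversion_inversion hx hy ‖x‖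
      have h4 := EuclideanGeometry.inversion_dist_center 0 x
      rw [dist_zero_right] at h4
      rw [h4, dist_eq_norm, dist_zero_right, dist_zero_right, dist_eq_norm] at h3
      rw [h3]; field_simp
    simp only [hf, e1, e2]
    have hρt : ‖y‖ = ‖x‖ / (‖x‖ / ‖y‖) := by field_simp
    set t := ‖x‖ / ‖y‖ with ht
    have ht0 : 0 < t := by positivity
    have hiff : ε ^ 2 * (‖x‖ * t) < (‖x - y‖ * t) ^ 2 * ‖x‖ ↔
        ε ^ 2 * ‖y‖ < ‖x - y‖ ^ 2 * ‖x‖ := by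
      have k1 : ε ^ 2 * (‖x‖ * t) = t ^ 2 * (ε ^ 2 * ‖y‖) := by
        rw [hρt]; field_simp
      have k2 : (‖x - y‖ * t) ^ 2 * ‖x‖ = t ^ 2 * (‖x - y‖ ^ 2 * ‖x‖) := by ring
      rw [k1, k2, mul_lt_mul_iff_right₀ (by positivity)]
    rw [if_congr hiff rfl rfl]
    split_ifs
    · have k2 : (t ^ 2) ^ N = t ^ γ * t ^ a := by
        rw [← Real.rpow_add ht0, ← pow_mul, ← Real.rpow_natCast]
        congr 1; push_cast; linarith
      have k3 : ‖y‖ ^ (-γ) = ‖x‖ ^ (-γ) * t ^ γ := by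
        rw [hρt, Real.div_rpow hR.le ht0.le, Real.rpow_neg ht0.le, div_inv_eq_mul]
      rw [k2, k3, Real.mul_rpow hR.le ht0.le, Real.mul_rpow (norm_nonneg _) ht0.le]
      have k4 : t ^ a * t ^ (-a) = 1 := by rw [← Real.rpow_add ht0]; simp
      have k5 : t ^ γ * t ^ (-γ) = 1 := by rw [← Real.rpow_add ht0]; simp
      calc _ = (‖x‖ ^ (-γ) * (t ^ γ - t ^ γ * t ^ (-γ))) * ‖x - y‖ ^ (-a) *
            (t ^ a * t ^ (-a)) := by ring
        _ = _ := by rw [k4, k5]; ring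
    · simp
  rw [h2, integral_neg] at h
  linarith

lemma integrable_norm_rpow_weight (hN : 1 ≤ N) {a γ : ℝ} (ha : (N : ℝ) < a) (hγ : 0 ≤ γ)
    (hγN : γ < N) : Integrable fun y : EuclideanSpace ℝ (Fin N) =>
      |‖y‖ ^ (-γ)| * (1 + ‖y‖) ^ (-a) := by
  have ha0 : 0 < a := (Nat.cast_nonneg N).trans_lt ha
  refine ((integrable_norm_rpow_of_le_one hN (b := -γ) (by linarith)).add
    (integrable_one_add_norm (E := EuclideanSpace ℝ (Fin N)) (μ := volume) (r := a)
    (by simpa using ha))).mono' (Measurable.aestronglyMeasurable (by fun_prop))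
    (ae_of_all _ fun y => ?_)
  have h1 : (1 + ‖y‖) ^ (-a) ≤ 1 :=
    Real.rpow_le_one_of_one_le_of_nonpos (by linarith [norm_nonneg y]) (by linarith)
  have h2 : 0 ≤ (1 + ‖y‖) ^ (-a) := by positivity
  have h3 : 0 ≤ ‖y‖ ^ (-γ) := by positivity
  rw [norm_mul, Real.norm_of_nonneg h2, norm_abs_eq_norm, Real.norm_of_nonneg h3]
  simp only [Pi.add_apply]
  split_ifs with h
  · nlinarith
  · have : ‖y‖ ^ (-γ) ≤ 1 :=
      Real.rpow_le_one_of_one_le_of_nonpos (not_le.1 h).le (by linarith)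
    nlinarith

/-- The fundamental solution is superharmonic for every truncated operator, away from `0`. -/
lemma truncOp_norm_rpow_nonneg (hN : 1 ≤ N) {a γ ε : ℝ} (ha : (N : ℝ) < a) (hγ : 0 < γ)
    (hγN : γ < N) (haγ : a + γ = 2 * N) (hε : 0 < ε) {x : EuclideanSpace ℝ (Fin N)} (hx : x ≠ 0) :
    0 ≤ truncOp a ε (fun y => ‖y‖ ^ (-γ)) x := by
  have hR : 0 < ‖x‖ := norm_pos_iff.2 hx
  rw [← integral_inversion_invariant_eq_zero hN haγ hx (ε := ε)]
  have hψm : Measurable fun y : EuclideanSpace ℝ (Fin N) => ‖y‖ ^ (-γ) := by fun_prop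
  have hψi := integrable_norm_rpow_weight hN ha hγ.le hγN
  have hint : ∀ ε', 0 < ε' → Integrable fun y =>
      (‖x‖ ^ (-γ) - ‖y‖ ^ (-γ)) * truncKernel a ε' (x - y) := fun ε' hε' =>
    integrable_diff_mul_truncKernel ha hε' hψm hψi x _
  -- The two truncations are compared pointwise. Where ‖y‖ > ‖x‖ the integrand is nonnegative and
  -- the round truncation keeps more of it; where ‖y‖ ≤ ‖x‖ it is nonpositive and the round
  -- truncation keeps less.
  refine integral_mono_ae ?_ (hint ε hε) ?_
  · refine (hint (min (‖x‖ / 2) (ε / 2)) (by positivity)).mono ?_ (ae_of_all _ fun y => ?_)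
    · exact Measurable.aestronglyMeasurable (Measurable.ite
        (measurableSet_lt (by fun_prop) (by fun_prop)) (by fun_prop) measurable_const)
    · split_ifs with h
      · have hd : min (‖x‖ / 2) (ε / 2) < ‖x - y‖ := by
          rw [min_lt_iff]
          by_contra! hcon
          have h1 : ‖x‖ / 2 ≤ ‖y‖ := by
            have := norm_sub_norm_le x y; linarith [hcon.1]
          have h2 : ‖x - y‖ ^ 2 ≤ (ε / 2) ^ 2 := pow_le_pow_left₀ (norm_nonneg _) hcon.2 2
          have h3 : ε ^ 2 * (‖x‖ / 2) ≤ ε ^ 2 * ‖y‖ :=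
            mul_le_mul_of_nonneg_left h1 (sq_nonneg _)
          have h4 := mul_le_mul_of_nonneg_right h2 hR.le
          have h5 : 0 < ε ^ 2 * ‖x‖ := by positivity
          nlinarith
        rw [truncKernel, if_pos hd]
      · simp only [norm_zero]; positivity
  · filter_upwards [ae_ne_zero hN] with y hy
    have hρ : 0 < ‖y‖ := norm_pos_iff.2 hy
    unfold truncKernel
    rcases lt_or_ge ‖x‖ ‖y‖ with hxy | hxy
    · have hc : 0 ≤ ‖x‖ ^ (-γ) - ‖y‖ ^ (-γ) :=
        sub_nonneg.2 (Real.rpow_le_rpow_of_nonpos hR hxy.le (by linarith))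
      by_cases h : ε ^ 2 * ‖y‖ < ‖x - y‖ ^ 2 * ‖x‖
      · have h1 : ε < ‖x - y‖ := by
          have h2 : ε ^ 2 * ‖x‖ < ‖x - y‖ ^ 2 * ‖x‖ :=
            (mul_le_mul_of_nonneg_left hxy.le (sq_nonneg _)).trans_lt h
          exact lt_of_pow_lt_pow_left₀ 2 (norm_nonneg _) (lt_of_mul_lt_mul_right h2 hR.le)
        rw [if_pos h, if_pos h1]
      · rw [if_neg h]
        split_ifs <;> positivity
    · have hc : ‖x‖ ^ (-γ) - ‖y‖ ^ (-γ) ≤ 0 :=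
        sub_nonpos.2 (Real.rpow_le_rpow_of_nonpos hρ hxy (by linarith))
      by_cases h1 : ε < ‖x - y‖
      · have h : ε ^ 2 * ‖y‖ < ‖x - y‖ ^ 2 * ‖x‖ := by
          have h2 : ε ^ 2 < ‖x - y‖ ^ 2 := pow_lt_pow_left₀ h1 hε.le two_ne_zero
          exact (mul_le_mul_of_nonneg_left hxy (sq_nonneg _)).trans_lt
            (mul_lt_mul_of_pos_right h2 hR)
        rw [if_pos h, if_pos h1]
      · rw [if_neg h1, mul_zero]
        split_ifs
        · exact mul_nonpos_of_nonpos_of_nonneg hc (by positivity)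
        · exact le_rfl

/-! ### Uniform integral bounds for the second-order error. -/

/-- The weight `(1 - t)² / (1 + t)`, quadratic at `1` and linear at infinity. -/
def quadLin (t : ℝ) : ℝ := (1 - t) ^ 2 / (1 + t)

lemma quadLin_nonneg {t : ℝ} (ht : 0 ≤ t) : 0 ≤ quadLin t := by
  unfold quadLin; positivity

lemma quadLin_le_sq {t : ℝ} (ht : 0 ≤ t) : quadLin t ≤ (1 - t) ^ 2 :=
  div_le_self (sq_nonneg _) (by linarith)

lemma quadLin_le_one_add {t : ℝ} (ht : 0 ≤ t) : quadLin t ≤ 1 + t := by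
  unfold quadLin
  rw [div_le_iff₀ (by linarith)]
  nlinarith

lemma abs_one_sub_rpow_neg_le {γ r : ℝ} (hγ : 0 < γ) (hr : 1 / 2 ≤ r) :
    |1 - r ^ (-γ)| ≤ γ * (1 / 2) ^ (-γ - 1) * |r - 1| := by
  have := Convex.norm_image_sub_le_of_norm_hasDerivWithin_le (s := Set.Ici (1 / 2 : ℝ))
    (f := fun r : ℝ => r ^ (-γ)) (f' := fun r => -γ * r ^ (-γ - 1)) (x := 1) (y := r)
    (C := γ * (1 / 2) ^ (-γ - 1)) (fun t ht => ?_) (fun t ht => ?_) (convex_Ici _) ?_ hr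
  · simp only [Real.one_rpow, Real.norm_eq_abs] at this
    rwa [abs_sub_comm]
  · have ht : (1 / 2 : ℝ) ≤ t := ht
    exact (Real.hasDerivAt_rpow_const (Or.inl (by linarith))).hasDerivWithinAt
  · have ht : (1 / 2 : ℝ) ≤ t := ht
    have ht0 : 0 < t := by linarith
    rw [norm_mul, norm_neg, Real.norm_of_nonneg hγ.le, Real.norm_of_nonneg (by positivity)]
    exact mul_le_mul_of_nonneg_left
      (Real.rpow_le_rpow_of_nonpos (by norm_num) ht (by linarith)) hγ.le
  · norm_num

lemma measurable_quadLin : Measurable quadLin := by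
  unfold quadLin; fun_prop

/-- Near e the quadratic vanishing at t = 1 tames the kernel, as a < N + 2. Elsewhere linear growth
leaves ‖y‖^(-γ), integrable at 0 because γ < N; a purely quadratic weight would need 2γ < N. -/
lemma integral_quadLin_unit_le (hN : 1 ≤ N) {a γ : ℝ} (ha : (N : ℝ) < a) (ha2 : a < N + 2)
    (hγ : 0 < γ) (hγN : γ < N) :
    ∃ Q, 0 ≤ Q ∧ ∀ e : EuclideanSpace ℝ (Fin N), ‖e‖ = 1 →
      Integrable (fun y => quadLin (‖y‖ ^ (-γ)) * ‖e - y‖ ^ (-a)) ∧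
      ∫ y, quadLin (‖y‖ ^ (-γ)) * ‖e - y‖ ^ (-a) ≤ Q := by
  have ha0 : 0 < a := (Nat.cast_nonneg N).trans_lt ha
  set L := γ * (1 / 2 : ℝ) ^ (-γ - 1) with hL
  set loc : EuclideanSpace ℝ (Fin N) → ℝ := fun h => if ‖h‖ ≤ 1 then ‖h‖ ^ (2 - a) else 0
    with hloc
  have hloci : Integrable loc := integrable_norm_rpow_of_le_one hN (by linarith)
  have hloc0 : ∀ h, 0 ≤ loc h := fun h => by
    simp only [hloc]; split_ifs <;> positivity
  have hK : Integrable (truncKernel a (1 / 2) : EuclideanSpace ℝ (Fin N) → ℝ) :=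
    integrable_truncKernel ha (by norm_num)
  have hψi := integrable_norm_rpow_weight hN ha hγ.le hγN
  set c := (1 + (1 + 1) / (1 / 2 : ℝ)) ^ a with hc
  have hc0 : 0 ≤ c := by positivity
  set I1 := ∫ h, loc h
  set I2 := ∫ h : EuclideanSpace ℝ (Fin N), truncKernel a (1 / 2) h
  set I3 := ∫ y : EuclideanSpace ℝ (Fin N), |‖y‖ ^ (-γ)| * (1 + ‖y‖) ^ (-a)
  have hI1 : 0 ≤ I1 := integral_nonneg hloc0
  have hI2 : 0 ≤ I2 := integral_nonneg fun h => truncKernel_nonneg _ _ _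
  have hI3 : 0 ≤ I3 := integral_nonneg fun h => by simp only [Pi.zero_apply]; positivity
  refine ⟨L ^ 2 * I1 + I2 + c * I3, by positivity, fun e he => ?_⟩
  have i1 := (hloci.comp_sub_left e).const_mul (L ^ 2)
  have i2 := hK.comp_sub_left e
  have i3 := hψi.const_mul c
  have hle : ∀ y, quadLin (‖y‖ ^ (-γ)) * ‖e - y‖ ^ (-a) ≤
      L ^ 2 * loc (e - y) + truncKernel a (1 / 2) (e - y) +
        c * (|‖y‖ ^ (-γ)| * (1 + ‖y‖) ^ (-a)) := by
    intro y
    have ht : 0 ≤ ‖y‖ ^ (-γ) := by positivity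
    have hq := quadLin_nonneg ht
    have hk0 := truncKernel_nonneg a (1 / 2) (e - y)
    have h0 : 0 ≤ c * (|‖y‖ ^ (-γ)| * (1 + ‖y‖) ^ (-a)) := by positivity
    rcases le_or_gt ‖e - y‖ (1 / 2) with h | h
    · have h1 : |‖y‖ - 1| ≤ ‖e - y‖ := by
        rw [abs_sub_comm, ← he]; exact abs_norm_sub_norm_le e y
      have h2 : quadLin (‖y‖ ^ (-γ)) ≤ L ^ 2 * ‖e - y‖ ^ 2 := by
        refine (quadLin_le_sq ht).trans ?_
        rw [← sq_abs, ← mul_pow]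
        refine pow_le_pow_left₀ (abs_nonneg _) ?_ 2
        have h3 : 1 / 2 ≤ ‖y‖ := by linarith [neg_abs_le (‖y‖ - 1)]
        exact (abs_one_sub_rpow_neg_le hγ h3).trans
          (mul_le_mul_of_nonneg_left h1 (by positivity))
      have h4 : quadLin (‖y‖ ^ (-γ)) * ‖e - y‖ ^ (-a) ≤ L ^ 2 * loc (e - y) := by
        simp only [hloc]
        rw [if_pos (by linarith)]
        rcases eq_or_ne (e - y) 0 with h5 | h5
        · have : ‖y‖ = 1 := by rw [← he, sub_eq_zero.1 h5]
          rw [this]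
          simp only [quadLin, Real.one_rpow, sub_self]
          norm_num
          positivity
        · calc _ ≤ L ^ 2 * ‖e - y‖ ^ 2 * ‖e - y‖ ^ (-a) :=
                mul_le_mul_of_nonneg_right h2 (by positivity)
            _ = _ := by
              rw [sub_eq_add_neg (2 : ℝ), Real.rpow_add (norm_pos_iff.2 h5), Real.rpow_two]
              ring
      linarith
    · have h1 : ‖e - y‖ ^ (-a) = truncKernel a (1 / 2) (e - y) := by
        rw [truncKernel, if_pos h]
      have h2 := truncKernel_sub_le ha0 (by norm_num : (0 : ℝ) < 1 / 2) zero_le_one he.le y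
      have h3 : 0 ≤ L ^ 2 * loc (e - y) := mul_nonneg (sq_nonneg _) (hloc0 _)
      rw [h1, abs_of_nonneg ht]
      have h4 := mul_le_mul_of_nonneg_right (quadLin_le_one_add ht) hk0
      have h5 := mul_le_mul_of_nonneg_left h2 ht
      have h6 : ‖y‖ ^ (-γ) * ((1 + (1 + 1) / (1 / 2)) ^ a * (1 + ‖y‖) ^ (-a)) =
          c * (‖y‖ ^ (-γ) * (1 + ‖y‖) ^ (-a)) := by rw [hc]; ring
      linarith
  have hi : Integrable (fun y => quadLin (‖y‖ ^ (-γ)) * ‖e - y‖ ^ (-a)) := by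
    refine ((i1.add i2).add i3).mono' ?_ (ae_of_all _ fun y => ?_)
    · have := measurable_quadLin
      exact Measurable.aestronglyMeasurable (by fun_prop)
    · rw [Real.norm_of_nonneg (mul_nonneg (quadLin_nonneg (by positivity)) (by positivity))]
      exact hle y
  refine ⟨hi, (integral_mono hi ((i1.add i2).add i3) hle).trans_eq ?_⟩
  rw [integral_add' (i1.add i2) i3, integral_add' i1 i2, integral_const_mul, integral_const_mul,
    integral_sub_left_eq_self loc volume e,
    integral_sub_left_eq_self (truncKernel a (1 / 2)) volume e]

/-- Rescaling by ‖x‖ reduces to a unit vector. -/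
lemma integral_quadLin_le (hN : 1 ≤ N) {a γ : ℝ} (ha : (N : ℝ) < a) (ha2 : a < N + 2)
    (hγ : 0 < γ) (hγN : γ < N) :
    ∃ Q, 0 ≤ Q ∧ ∀ x : EuclideanSpace ℝ (Fin N), x ≠ 0 →
      Integrable (fun y => quadLin (‖y‖ ^ (-γ) / ‖x‖ ^ (-γ)) * ‖x - y‖ ^ (-a)) ∧
      ∫ y, quadLin (‖y‖ ^ (-γ) / ‖x‖ ^ (-γ)) * ‖x - y‖ ^ (-a) ≤ Q * ‖x‖ ^ (N - a) := by
  obtain ⟨Q, hQ0, hQ⟩ := integral_quadLin_unit_le hN ha ha2 hγ hγN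
  refine ⟨Q, hQ0, fun x hx => ?_⟩
  have hR : 0 < ‖x‖ := norm_pos_iff.2 hx
  obtain ⟨hi, hle⟩ := hQ (‖x‖⁻¹ • x) (by rw [norm_smul, norm_inv, norm_norm]; field_simp)
  set f : EuclideanSpace ℝ (Fin N) → ℝ :=
    fun y => quadLin (‖y‖ ^ (-γ) / ‖x‖ ^ (-γ)) * ‖x - y‖ ^ (-a) with hf
  have hcomp : (fun z => f (‖x‖ • z)) = fun z =>
      ‖x‖ ^ (-a) * (quadLin (‖z‖ ^ (-γ)) * ‖‖x‖⁻¹ • x - z‖ ^ (-a)) := by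
    funext z
    have e1 : x - ‖x‖ • z = ‖x‖ • (‖x‖⁻¹ • x - z) := by
      rw [smul_sub, smul_smul, mul_inv_cancel₀ hR.ne', one_smul]
    simp only [hf]
    rw [e1, norm_smul, norm_smul, norm_norm, Real.mul_rpow hR.le (norm_nonneg _),
      Real.mul_rpow hR.le (norm_nonneg _), mul_div_cancel_left₀ _ (by positivity)]
    ring
  have hfi : Integrable f := by
    rw [← integrable_comp_smul_iff volume f hR.ne', hcomp]
    exact hi.const_mul _
  refine ⟨hfi, ?_⟩
  have h := Measure.integral_comp_smul volume f ‖x‖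
  rw [hcomp, integral_const_mul, finrank_euclideanSpace, Fintype.card_fin,
    abs_of_pos (by positivity), smul_eq_mul, ← Real.rpow_natCast] at h
  have h2 : ∫ y, f y = ‖x‖ ^ ((N : ℝ) - a) *
      ∫ y, quadLin (‖y‖ ^ (-γ)) * ‖‖x‖⁻¹ • x - y‖ ^ (-a) := by
    rw [sub_eq_add_neg, Real.rpow_add hR, mul_assoc, h, ← mul_assoc, mul_inv_cancel₀
      (by positivity), one_mul]
  rw [h2, mul_comm Q]
  exact mul_le_mul_of_nonneg_left hle (by positivity)

/-! ### Convex cutoff of the fundamental solution. -/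

/-- The convex cutoff `(t - δ)₊² / t`, which vanishes for `t ≤ δ`. -/
def convexCutoff (δ t : ℝ) : ℝ := max (t - δ) 0 ^ 2 / t

lemma convexCutoff_nonneg {δ t : ℝ} (ht : 0 ≤ t) : 0 ≤ convexCutoff δ t := by
  unfold convexCutoff; positivity

lemma convexCutoff_of_le {δ t : ℝ} (h : t ≤ δ) : convexCutoff δ t = 0 := by
  simp [convexCutoff, max_eq_right (sub_nonpos.2 h)]

lemma convexCutoff_of_ge {δ t : ℝ} (h : δ ≤ t) : convexCutoff δ t = (t - δ) ^ 2 / t := by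
  simp [convexCutoff, max_eq_left (sub_nonneg.2 h)]

lemma convexCutoff_mono {δ t t' : ℝ} (hδ : 0 ≤ δ) (ht : 0 < t) (h : t ≤ t') :
    convexCutoff δ t ≤ convexCutoff δ t' := by
  rcases le_total t δ with h1 | h1
  · rw [convexCutoff_of_le h1]; exact convexCutoff_nonneg (by linarith)
  · rw [convexCutoff_of_ge h1, convexCutoff_of_ge (h1.trans h),
      div_le_div_iff₀ ht (by linarith)]
    have h2 : 0 ≤ (t' - t) * (t * t' - δ * δ) :=
      mul_nonneg (by linarith) (sub_nonneg.2 (mul_le_mul h1 (h1.trans h) hδ ht.le))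
    nlinarith

lemma convexCutoff_anti {δ δ' t : ℝ} (ht : 0 ≤ t) (h : δ ≤ δ') :
    convexCutoff δ' t ≤ convexCutoff δ t := by
  unfold convexCutoff
  gcongr

/-- Here d is the derivative of the cutoff at a, and the last term bounds the excess over the
tangent line. For t > δ the cutoff equals t - 2δ + δ²/t, nearly linear, so the excess carries a
factor δ; for a ≤ δ the tangent is zero and the factor is a. -/
lemma convexCutoff_sub_le {δ a : ℝ} (hδ : 0 < δ) (ha : 0 < a) :
    ∃ d, 0 ≤ d ∧ ∀ b, 0 < b →
      convexCutoff δ b - convexCutoff δ a ≤ d * (b - a) + 4 * min δ a * quadLin (b / a) := by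
  have hq : ∀ b, 0 < b → quadLin (b / a) = (a - b) ^ 2 / (a * (a + b)) := by
    intro b hb
    unfold quadLin
    field_simp
  rcases lt_or_ge δ a with h | h
  · refine ⟨1 - δ ^ 2 / a ^ 2, ?_, fun b hb => ?_⟩
    · rw [sub_nonneg, div_le_one (by positivity)]
      exact pow_le_pow_left₀ hδ.le h.le 2
    rw [min_eq_left h.le, convexCutoff_of_ge h.le, hq b hb]
    rcases le_total b δ with hb1 | hb1
    · rw [convexCutoff_of_le hb1]
      have h1 : 0 - (a - δ) ^ 2 / a - (1 - δ ^ 2 / a ^ 2) * (b - a) =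
          (a - δ) * (2 * δ * a - a * b - b * δ) / a ^ 2 := by
        field_simp; ring
      have h2 : (a - δ) * (2 * δ * a - a * b - b * δ) / a ^ 2 ≤
          4 * δ * ((a - b) ^ 2 / (a * (a + b))) := by
        rw [← mul_div_assoc, div_le_div_iff₀ (by positivity) (by positivity)]
        have k1 : 2 * δ * a - a * b - b * δ ≤ 2 * δ * (a - b) := by nlinarith
        have k2 : 0 ≤ a - δ := by linarith
        have k3 : 0 ≤ a - b := by linarith
        calc (a - δ) * (2 * δ * a - a * b - b * δ) * (a * (a + b))
            ≤ (a - δ) * (2 * δ * (a - b)) * (a * (a + b)) := by gcongr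
          _ ≤ (a - b) * (2 * δ * (a - b)) * (a * (a + a)) := by gcongr; linarith
          _ = _ := by ring
      linarith
    · rw [convexCutoff_of_ge hb1]
      have h1 : (b - δ) ^ 2 / b - (a - δ) ^ 2 / a - (1 - δ ^ 2 / a ^ 2) * (b - a) =
          δ ^ 2 * (a - b) ^ 2 / (a ^ 2 * b) := by
        field_simp; ring
      have h2 : δ ^ 2 * (a - b) ^ 2 / (a ^ 2 * b) ≤ 4 * δ * ((a - b) ^ 2 / (a * (a + b))) := by
        rw [← mul_div_assoc, div_le_div_iff₀ (by positivity) (by positivity)]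
        have k1 : δ * (a + b) ≤ 4 * (a * b) := by nlinarith
        have k2 : 0 ≤ δ * (a - b) ^ 2 * a := by positivity
        have k3 := mul_le_mul_of_nonneg_left k1 k2
        nlinarith
      linarith
  · refine ⟨0, le_rfl, fun b hb => ?_⟩
    rw [min_eq_right h, convexCutoff_of_le h, hq b hb, zero_mul, zero_add, sub_zero]
    rcases le_total b δ with hb1 | hb1
    · rw [convexCutoff_of_le hb1]; positivity
    · rw [convexCutoff_of_ge hb1, ← mul_div_assoc, div_le_div_iff₀ hb (by positivity)]
      have k1 : (b - δ) ^ 2 ≤ (a - b) ^ 2 := by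
        rw [← sub_sq_comm b a]
        exact pow_le_pow_left₀ (by linarith) (by linarith) 2
      have k2 : a * (a + b) ≤ 4 * a * b := by nlinarith
      calc (b - δ) ^ 2 * (a * (a + b)) ≤ (a - b) ^ 2 * (4 * a * b) := by gcongr
        _ = _ := by ring

/-- The fundamental solution `‖x‖^(-γ)`, capped at `1` and cut off at level `δ`. -/
def cutFundamental (γ δ : ℝ) (x : EuclideanSpace ℝ (Fin N)) : ℝ :=
  convexCutoff δ ((max ‖x‖ 1) ^ (-γ))

lemma cutFundamental_nonneg (γ δ : ℝ) (x : EuclideanSpace ℝ (Fin N)) :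
    0 ≤ cutFundamental γ δ x :=
  convexCutoff_nonneg (by positivity)

lemma continuous_cutFundamental (γ δ : ℝ) :
    Continuous (cutFundamental γ δ : EuclideanSpace ℝ (Fin N) → ℝ) := by
  have hpos : ∀ x : EuclideanSpace ℝ (Fin N), 0 < max ‖x‖ 1 := fun x =>
    lt_max_of_lt_right one_pos
  have h : Continuous fun x : EuclideanSpace ℝ (Fin N) => (max ‖x‖ 1) ^ (-γ) :=
    Continuous.rpow_const (by fun_prop) fun x => Or.inl (hpos x).ne'
  unfold cutFundamental convexCutoff
  exact Continuous.div (by fun_prop) h fun x => (Real.rpow_pos_of_pos (hpos x) _).ne'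

lemma hasCompactSupport_cutFundamental {γ R : ℝ} (hγ : 0 < γ) (hR : 0 < R) :
    HasCompactSupport (cutFundamental γ (R ^ (-γ)) : EuclideanSpace ℝ (Fin N) → ℝ) := by
  refine HasCompactSupport.of_support_subset_isCompact (isCompact_closedBall 0 R) fun x hx => ?_
  by_contra h
  rw [mem_closedBall_zero_iff, not_le] at h
  exact hx (convexCutoff_of_le (Real.rpow_le_rpow_of_nonpos hR
    (h.le.trans (le_max_left _ _)) (by linarith)))

/-- Lower bound for the truncated operators on the cut-off fundamental solution. -/
lemma neg_le_truncOp_cutFundamental (hN : 1 ≤ N) {s : ℝ} (hs0 : 0 < s) (hs1 : s < 1)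
    (hNs : 2 * s < N) :
    ∃ Q, 0 ≤ Q ∧ ∀ R ε, 0 < R → 0 < ε → ∀ x : EuclideanSpace ℝ (Fin N),
      -(Q * min (R ^ (-(N - 2 * s))) ((max ‖x‖ 1) ^ (-(N - 2 * s))) * (max ‖x‖ 1) ^ (-(2 * s))) ≤
        truncOp (N + 2 * s) ε (cutFundamental (N - 2 * s) (R ^ (-(N - 2 * s)))) x := by
  have ha : (N : ℝ) < N + 2 * s := by linarith
  have hγ : 0 < N - 2 * s := by linarith
  have hγN : N - 2 * s < N := by linarith
  have haγ : ((N : ℝ) + 2 * s) + (N - 2 * s) = 2 * N := by ring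
  have hNa : (N : ℝ) - (N + 2 * s) = -(2 * s) := by ring
  obtain ⟨Q, hQ0, hQ⟩ := integral_quadLin_le hN ha (by linarith : N + 2 * s < N + 2) hγ hγN
  rw [hNa] at hQ
  set a := (N : ℝ) + 2 * s
  set γ := (N : ℝ) - 2 * s
  refine ⟨4 * Q, by positivity, fun R ε hR hε x => ?_⟩
  set δ := R ^ (-γ)
  have hδ : 0 < δ := by positivity
  -- On the unit ball the capped function attains its maximum, so the operator is nonnegative there.
  rcases le_or_gt ‖x‖ 1 with hx | hx
  · refine le_trans (neg_nonpos.2 (by positivity)) (integral_nonneg fun y => ?_)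
    refine mul_nonneg (sub_nonneg.2 ?_) (truncKernel_nonneg _ _ _)
    unfold cutFundamental
    refine convexCutoff_mono hδ.le (by positivity) ?_
    rw [max_eq_right hx]
    exact Real.rpow_le_rpow_of_nonpos one_pos (le_max_right _ _) (by linarith)
  have hR0 : 0 < ‖x‖ := by linarith
  have hx0 : x ≠ 0 := norm_pos_iff.1 hR0
  rw [max_eq_left hx.le]
  obtain ⟨hqi, hqle⟩ := hQ x hx0
  set b := ‖x‖ ^ (-γ)
  have hb : 0 < b := by positivity
  obtain ⟨d, hd0, hd⟩ := convexCutoff_sub_le hδ hb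
  have hψi := integrable_norm_rpow_weight hN ha hγ.le hγN
  have hsup := truncOp_norm_rpow_nonneg hN ha hγ hγN haγ hε hx0
  have i1 := integrable_diff_mul_truncKernel ha hε
    (by fun_prop : Measurable fun y : EuclideanSpace ℝ (Fin N) => ‖y‖ ^ (-γ)) hψi x b
  have hφc := continuous_cutFundamental (N := N) γ δ
  have hφi : Integrable fun y : EuclideanSpace ℝ (Fin N) =>
      |cutFundamental γ δ y| * (1 + ‖y‖) ^ (-a) := by
    refine Continuous.integrable_of_hasCompactSupport ?_
      ((hasCompactSupport_cutFundamental hγ hR).comp_left (g := abs) abs_zero).mul_right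
    exact hφc.abs.mul (Continuous.rpow_const (by fun_prop) fun y => Or.inl (by positivity))
  -- For ‖x‖ > 1 the cap leaves the value at x unchanged and only lowers values elsewhere, which
  -- helps. The tangent term has a good sign by superharmonicity and d ≥ 0. The error term is
  -- integrated against the full kernel, making the bound uniform in ε.
  have hle : ∫ y, (d * ((b - ‖y‖ ^ (-γ)) * truncKernel a ε (x - y)) -
      4 * min δ b * (quadLin (‖y‖ ^ (-γ) / b) * ‖x - y‖ ^ (-a))) ≤
      truncOp a ε (cutFundamental γ δ) x := by
    refine integral_mono_ae ((i1.const_mul d).sub (hqi.const_mul _))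
      (integrable_diff_mul_truncKernel ha hε hφc.measurable hφi x _) ?_
    filter_upwards [ae_ne_zero hN] with y hy
    have hy0 : 0 < ‖y‖ := norm_pos_iff.2 hy
    have hk0 := truncKernel_nonneg a ε (x - y)
    have hk1 : truncKernel a ε (x - y) ≤ ‖x - y‖ ^ (-a) := by
      unfold truncKernel
      split_ifs
      · exact le_rfl
      · positivity
    have h1 : cutFundamental γ δ y ≤ convexCutoff δ (‖y‖ ^ (-γ)) :=
      convexCutoff_mono hδ.le (by positivity)
        (Real.rpow_le_rpow_of_nonpos hy0 (le_max_left _ _) (by linarith))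
    have h2 : cutFundamental γ δ x = convexCutoff δ b := by
      unfold cutFundamental; rw [max_eq_left hx.le]
    have h3 := hd (‖y‖ ^ (-γ)) (by positivity)
    have hq0 : 0 ≤ 4 * min δ b * quadLin (‖y‖ ^ (-γ) / b) :=
      mul_nonneg (by positivity) (quadLin_nonneg (by positivity))
    rw [h2]
    have h4 : d * (b - ‖y‖ ^ (-γ)) - 4 * min δ b * quadLin (‖y‖ ^ (-γ) / b) ≤
        convexCutoff δ b - cutFundamental γ δ y := by linarith
    have h5 := mul_le_mul_of_nonneg_right h4 hk0
    have h6 := mul_le_mul_of_nonneg_left hk1 hq0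
    linarith
  rw [integral_sub (i1.const_mul d) (hqi.const_mul _), integral_const_mul,
    integral_const_mul] at hle
  have h1 : 0 ≤ d * ∫ y, (b - ‖y‖ ^ (-γ)) * truncKernel a ε (x - y) := mul_nonneg hd0 hsup
  have h2 := mul_le_mul_of_nonneg_left hqle (by positivity : 0 ≤ 4 * min δ b)
  linarith

/-- The exponents balance: γ + 2s = N, so the error is dominated by the critical weight for every n,
while the factor min(δ, ·) sends it to 0 as δ = (n + 1)^(-γ) does. -/
theorem eq_zero_of_two_mul_lt (hN : 1 ≤ N) {s p : ℝ} (hs0 : 0 < s) (hs1 : s < 1) (hp : 1 ≤ p)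
    (hNs : 2 * s < N)
    {V u : EuclideanSpace ℝ (Fin N) → ℝ} (hV : Continuous V) (hV0 : ∀ x, 0 < V x)
    (huL : MemFracL s u) (hur : FracRegular s u)
    (hueq : ∀ x, HasFracLaplacianAt s u x (-(V x * u x)))
    (hwi : Integrable fun y => |u y| ^ p * (1 + ‖y‖) ^ (-(N : ℝ)))
    (x : EuclideanSpace ℝ (Fin N)) : u x = 0 := by
  obtain ⟨Q, hQ0, hQ⟩ := neg_le_truncOp_cutFundamental hN hs0 hs1 hNs
  have hγ : 0 < N - 2 * s := by linarith
  have hγs : -((N : ℝ) - 2 * s) + -(2 * s) = -N := by ring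
  set γ := (N : ℝ) - 2 * s
  have hn : ∀ n : ℕ, (0 : ℝ) < (n : ℝ) + 1 := fun n => by positivity
  refine eq_zero_of_test_functions hN hs0 hs1 hp hV hV0 huL hur hueq hwi
    (φ := fun n => cutFundamental γ (((n : ℝ) + 1) ^ (-γ)))
    (E := fun n y => Q * min (((n : ℝ) + 1) ^ (-γ)) ((max ‖y‖ 1) ^ (-γ)) *
      (max ‖y‖ 1) ^ (-(2 * s))) (C := Q * 2 ^ (N : ℝ))
    (fun n => continuous_cutFundamental _ _)
    (fun n => hasCompactSupport_cutFundamental hγ (hn n))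
    (fun n y => cutFundamental_nonneg _ _ _) (fun n k hnk y => ?_) (fun y => ?_)
    (fun n ε hε _ y => hQ _ ε (hn n) hε y) (fun n => by fun_prop) (fun n y => ?_)
    (fun y => ?_) x
  · have h : (n : ℝ) ≤ k := by exact_mod_cast hnk
    exact convexCutoff_anti (by positivity)
      (Real.rpow_le_rpow_of_nonpos (hn n) (by linarith) (by linarith))
  · obtain ⟨n, hn'⟩ := exists_nat_gt (max ‖y‖ 1)
    refine ⟨n, ?_⟩
    have h1 : ((n : ℝ) + 1) ^ (-γ) < (max ‖y‖ 1) ^ (-γ) :=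
      Real.rpow_lt_rpow_of_neg (lt_max_of_lt_right one_pos) (by linarith) (by linarith)
    have h2 : 0 < (max ‖y‖ 1) ^ (-γ) - ((n : ℝ) + 1) ^ (-γ) := by linarith
    simp only [cutFundamental]
    rw [convexCutoff_of_ge h1.le]
    positivity
  · have h0 : 0 < max ‖y‖ 1 := lt_max_of_lt_right one_pos
    have := hn n
    rw [abs_of_nonneg (by positivity), mul_assoc, mul_assoc]
    refine mul_le_mul_of_nonneg_left ?_ hQ0
    calc _ ≤ (max ‖y‖ 1) ^ (-γ) * (max ‖y‖ 1) ^ (-(2 * s)) :=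
          mul_le_mul_of_nonneg_right (min_le_right _ _) (by positivity)
      _ = (max 1 ‖y‖) ^ (-(N : ℝ)) := by rw [← Real.rpow_add h0, hγs, max_comm]
      _ ≤ _ := max_one_norm_rpow_le y
  · have h1 : Tendsto (fun n : ℕ => ((n : ℝ) + 1) ^ (-γ)) atTop (𝓝 0) :=
      (tendsto_rpow_neg_atTop hγ).comp
        (tendsto_atTop_add_const_right _ _ tendsto_natCast_atTop_atTop)
    have h2 := h1.min (tendsto_const_nhds (x := (max ‖y‖ 1) ^ (-γ)))
    rw [min_eq_left (by positivity)] at h2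
    simpa using (h2.const_mul Q).mul_const ((max ‖y‖ 1) ^ (-(2 * s)))

/-- Since `α ≤ 2s`, the weight of the hypothesis dominates `(1 + ‖x‖)^(-N)` at infinity. -/
lemma integrable_rpow_weight_of_memWeightedLp {s α p : ℝ} (hα : α ≤ 2 * s) (hp : 1 ≤ p)
    {u : EuclideanSpace ℝ (Fin N) → ℝ} (hu : Continuous u)
    (hup : MemWeightedLp p (fun x => 1 / (1 + ‖x‖ ^ ((N : ℝ) - 2 * s + α))) u) :
    Integrable fun y => |u y| ^ p * (1 + ‖y‖) ^ (-(N : ℝ)) := by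
  have hwc : Continuous fun x => |u x| ^ p := hu.abs.rpow_const fun _ => Or.inr (by linarith)
  -- On the unit ball the two weights need not be comparable, since N - 2s + α may be negative;
  -- continuity of u is used there instead.
  have i1 : IntegrableOn (fun y => |u y| ^ p) (Metric.closedBall 0 1) :=
    hwc.continuousOn.integrableOn_compact (isCompact_closedBall _ _)
  have i2 := i1.integrable_indicator Metric.isClosed_closedBall.measurableSet
  refine (i2.add (hup.2.const_mul 2)).mono' (Measurable.aestronglyMeasurable
    (hwc.measurable.mul (by fun_prop))) (ae_of_all _ fun y => ?_)
  have hw : 0 ≤ |u y| ^ p := by positivity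
  rw [Real.norm_of_nonneg (by positivity)]
  simp only [Pi.add_apply]
  by_cases hy : y ∈ Metric.closedBall (0 : EuclideanSpace ℝ (Fin N)) 1
  · rw [Set.indicator_of_mem hy]
    have h1 : (1 + ‖y‖) ^ (-(N : ℝ)) ≤ 1 :=
      Real.rpow_le_one_of_one_le_of_nonpos (by linarith [norm_nonneg y]) (by simp)
    have h2 : 0 ≤ 2 * (|u y| ^ p * (1 / (1 + ‖y‖ ^ ((N : ℝ) - 2 * s + α)))) := by positivity
    nlinarith
  · rw [Set.indicator_of_notMem hy, zero_add]
    rw [mem_closedBall_zero_iff, not_le] at hy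
    have h1 : (1 + ‖y‖) ^ (-(N : ℝ)) ≤ 2 * (1 / (1 + ‖y‖ ^ ((N : ℝ) - 2 * s + α))) := by
      refine (rpow_one_add_le (Nat.cast_nonneg N) (norm_nonneg y)).trans ?_
      have h2 : ‖y‖ ^ ((N : ℝ) - 2 * s + α) ≤ ‖y‖ ^ (N : ℝ) :=
        Real.rpow_le_rpow_of_exponent_le hy.le (by linarith)
      gcongr
    calc _ ≤ |u y| ^ p * (2 * (1 / (1 + ‖y‖ ^ ((N : ℝ) - 2 * s + α)))) :=
          mul_le_mul_of_nonneg_left h1 hw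
      _ = _ := by ring

end Transient

end

theorem corollary2p12 (N : ℕ) (hN : 1 ≤ N) (s : ℝ) (hs0 : 0 < s) (hs1 : s < 1)
    (ρ c u : EuclideanSpace ℝ (Fin N) → ℝ)
    (hρ_cont : Continuous ρ) (hρ_pos : ∀ x, 0 < ρ x)
    (K α : ℝ) (hK : 0 < K) (hα : α ≤ 2 * s)
    (hρ_lower : ∀ x, K * (1 + ‖x‖ ^ 2) ^ (-α) ≤ ρ x)
    (hc_cont : Continuous c) (hc_nonneg : ∀ x, 0 ≤ c x)
    (hc_bdd : MemLp c ⊤ volume)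
    (c₀ : ℝ) (hc₀ : 0 < c₀) (hc_lower : ∀ x, c₀ ≤ c x)
    (hu : IsFracEllipticSolution s ρ c u)
    (p : ℝ) (hp : 1 ≤ p)
    (hup : MemWeightedLp p (fun x => 1 / (1 + ‖x‖ ^ ((N : ℝ) - 2 * s + α))) u) :
    ∀ x, u x = 0 := by
  have hV : Continuous fun x => ρ x * c x := hρ_cont.mul hc_cont
  have hV0 : ∀ x, 0 < ρ x * c x := fun x => mul_pos (hρ_pos x) (hc₀.trans_le (hc_lower x))
  have hueq : ∀ x, HasFracLaplacianAt s u x (-((ρ x * c x) * u x)) := by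
    intro x
    obtain ⟨L, hL, h0⟩ := hu.equation x
    rwa [← eq_neg_of_add_eq_zero_left h0]
  have hwi := integrable_rpow_weight_of_memWeightedLp hα hp (hu.regular.second_diff hs0).1 hup
  rcases le_or_gt (N : ℝ) (2 * s) with h | h
  · exact eq_zero_of_le_two_mul hN hs0 hs1 hp h hV hV0 hu.memFracL hu.regular hueq hwi
  · exact eq_zero_of_two_mul_lt hN hs0 hs1 hp h hV hV0 hu.memFracL hu.regular hueq hwi
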